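/- **Setting.** An *f-system* on $[0,\infty)$ is a nonempty collection $\mathcal F$ of subsets of $[0,\infty)$ closed under complements and under unions of two disjoint members. A *probability pair* is a pair $(\mathcal F,\mu)$ with $\mathcal F$ an f-system on $[0,\infty)$ and $\mu:\mathcal F\to[0,1]$ satisfying $\mu([0,\infty))=1$ and $\mu(A\cup B)=\mu(A)+\mu(B)$ for disjoint $A,B\in\mathcal F$; $\mu$ is *coherent* if $\sup_{x\ge 0}\sum_{i=1}^n a_i(1_{A_i}(x)-\mu(A_i))\ge 0$ for all $n$, $a_1,\dots,a_n\in\mathbb R$ and $A_1,\dots,A_n\in\mathcal F$. Given a collection $P$ of probability pairs, $(\mathcal F,\mu)\in P$ is *canonical with respect to $P$* if $\mu(A)=\mu'(A)$ for every $A\in\mathcal F$ and every $(\mathcal F',\mu')\in P$ with $A\in\mathcal F'$. Let $\mathcal M$ be the algebra of all sets $\bigcup_{i\ge1}[a_{2i-1},a_{2i})$ with $0\le a_1\le a_2\le\cdots$ and $a_i\to\infty$. For $A\in\mathcal M$ put $\rho_A(0)=0$ and $\rho_A(x)=\frac1x\int_0^x1_A(y)\,dy$ for $x>0$, and $S_A(x)=m(A\cap[0,x))$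 with $m$ Lebesgue measure. Let $\mathcal C$ be the collection of all $A\in\mathcal M$ for which $\lambda(A)=\lim_{x\to\infty}\rho_A(x)$ exists. For $A,B\in\mathcal M$ let $A\circ B=\{x\in A: S_A(x)\in B\}$. A *weakly thinnable pair* (WTP) is a probability pair $(\mathcal F,\mu)$ with $\mathcal F\subseteq\mathcal M$ such that (P1) $C\circ A\in\mathcal F$ and $\mu(C\circ A)=\mu(C)\mu(A)$ for all $C\in\mathcal C$, $A\in\mathcal F$; (P2) if $A,B\in\mathcal F$ and $S_A(x)\ge S_B(x)$ for all $x\ge0$, then $\mu(A)\ge\mu(B)$; (P3) $\mu([c,\infty))=1$ for all $c\ge0$. (By P1 with $A=[0,\infty)$, $\mathcal C\subseteq\mathcal F$.) Let $WT$ be the collection of all WTPs and $WTC$ the collection of those with $\mu$ coherent. For $A\in\mathcal M$ let $\sigma_A(D,x)=\frac1D\int_x^{x+D}1_A(y)\,dy$, $U(A)=\limsup_{D\to\infty}\sup_{x>0}\sigma_A(D,x)$, $L(A)=\liminf_{D\to\infty}\inf_{x>0}\sigma_A(D,x)$, and $\log(A)=\{\log a:a\in A\cap[1,\infty)\}$.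 Let $\mathcal A^{\mathrm{uni}}=\{A\in\mathcal M: L(\log(A))=U(\log(A))\}$ and $\alpha(A)=\lambda(\log(A))$ for $A\in\mathcal A^{\mathrm{uni}}$. Finally let $\xi_A(D,x)=\frac1{\log D}\int_x^{Dx}\frac{\rho_A(y)}y\,dy$ for $D,x>1$. **Theorem.** 1. For every $A\in\mathcal A^{\mathrm{uni}}$ we have $\log(A)\in\mathcal C$ (so $\alpha(A)$ is well defined). The pair $(\mathcal A^{\mathrm{uni}},\alpha)$ is a WTP, $\alpha$ is coherent, and $(\mathcal A^{\mathrm{uni}},\alpha)$ extends to a WTP $(\mathcal M,\mu)$. More precisely, for every free ultrafilter $\mathcal U$ on $\mathbb N$ and all sequences $s_n,f_n\in(1,\infty)$ with $s_n\to\infty$, the limit $\mu(A)=\mathcal U\text{-}\lim_n\xi_A(s_n,f_n)$ exists for every $A\in\mathcal M$, and $(\mathcal M,\mu)$ is a WTP that extends $(\mathcal A^{\mathrm{uni}},\alpha)$. 2. The pair $(\mathcal A^{\mathrm{uni}},\alpha)$ is canonical with respect to both $WT$ and $WTC$. Moreover $L(\log(A))\le\mu(A)\le U(\log(A))$ for every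 WTP $(\mathcal F,\mu)$ and every $A\in\mathcal F$. 3. If a pair $(\mathcal F,\mu)$ is canonical with respect to $WT$ or with respect to $WTC$, then $\mathcal F\subseteq\mathcal A^{\mathrm{uni}}$. -/

import Mathlib

open Set Filter Topology MeasureTheory

noncomputable section

namespace WeakThinnability

/-! ### Probability pairs on a set

A pair `(F, μ)` consists of a collection `F` of subsets of `X` and a map `μ`. The map is written as
a total function on sets, but every notion below only involves its values on members of `F`. -/

/-- An f-system on `X`: a nonempty collection of subsets of `X` closed under disjoint unions and
under complements in `X`. -/
structure IsFSystem {Ω : Type*} (X : Set Ω) (F : Set (Set Ω)) : Prop where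
  nonempty : F.Nonempty
  subset : ∀ A ∈ F, A ⊆ X
  union_mem : ∀ A ∈ F, ∀ B ∈ F, A ∩ B = ∅ → A ∪ B ∈ F
  compl_mem : ∀ A ∈ F, X \ A ∈ F

/-- `(F, μ)` is a probability pair on `X`: `F` is an f-system on `X` and `μ : F → [0,1]` is a
finitely additive probability measure. -/
structure IsProbabilityPair {Ω : Type*} (X : Set Ω) (F : Set (Set Ω)) (μ : Set Ω → ℝ) : Prop where
  fsystem : IsFSystem X F
  mem_unit : ∀ A ∈ F, μ A ∈ Icc (0 : ℝ) 1
  additive : ∀ A ∈ F, ∀ B ∈ F, A ∩ B = ∅ → μ (A ∪ B) = μ A + μ B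
  total : μ X = 1

/-- Coherence of `μ` on `F`: no finite system of bets on members of `F` yields a guaranteed net
loss. (The supremum is over a bounded set of reals.) -/
def IsCoherent {Ω : Type*} (X : Set Ω) (F : Set (Set Ω)) (μ : Set Ω → ℝ) : Prop :=
  ∀ (n : ℕ) (a : Fin n → ℝ) (A : Fin n → Set Ω), (∀ i, A i ∈ F) →
    0 ≤ ⨆ x : X, ∑ i, a i * ((A i).indicator (fun _ => (1 : ℝ)) (x : Ω) - μ (A i))

/-- The pair `p = (F, μ)` belongs to the collection `P` of pairs and is canonical with respect
to `P`: every pair in `P` that measures a set `A ∈ F` gives it the value `μ A`. -/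
def IsCanonical {Ω : Type*} (P : Set (Set (Set Ω) × (Set Ω → ℝ)))
    (p : Set (Set Ω) × (Set Ω → ℝ)) : Prop :=
  p ∈ P ∧ ∀ A ∈ p.1, ∀ q ∈ P, A ∈ q.1 → p.2 A = q.2 A

/-! ### The algebra `𝓜` on `[0, ∞)`, natural density, and thinning -/

/-- The half-line `[0, ∞)`. -/
def halfLine : Set ℝ := Ici 0

/-- The algebra `𝓜` of all unions `⋃ i, [a (2 i), a (2 i + 1))` with `0 ≤ a 0 ≤ a 1 ≤ ⋯` and
`a i → ∞`. Repetitions are allowed, so finite unions and unbounded intervals are included. -/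
def intervalSets : Set (Set ℝ) :=
  {A | ∃ a : ℕ → ℝ, 0 ≤ a 0 ∧ Monotone a ∧ Tendsto a atTop atTop ∧
    A = ⋃ i : ℕ, Ico (a (2 * i)) (a (2 * i + 1))}

/-- `1_A` as a real function. -/
def ind (A : Set ℝ) : ℝ → ℝ := A.indicator (fun _ => 1)

/-- `ρ_A(x) = (1/x) ∫_0^x 1_A(y) dy`, with `ρ_A(0) = 0`. -/
def rho (A : Set ℝ) (x : ℝ) : ℝ := (1 / x) * ∫ y in (0 : ℝ)..x, ind A y

/-- `𝓒`: the members of `𝓜` that have a natural density. -/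
def densitySets : Set (Set ℝ) :=
  {A | A ∈ intervalSets ∧ ∃ l : ℝ, Tendsto (rho A) atTop (𝓝 l)}

/-- `λ(A)`: the natural density of `A ∈ 𝓒`. -/
def density (A : Set ℝ) : ℝ := limUnder atTop (rho A)

/-- `S_A(x) = m(A ∩ [0, x))`. -/
def cumul (A : Set ℝ) (x : ℝ) : ℝ := (volume (A ∩ Ico 0 x)).toReal

/-- The thinning `A ∘ B = {x ∈ [0, ∞) : x ∈ A and S_A(x) ∈ B}`. -/
def thin (A B : Set ℝ) : Set ℝ := {x | x ∈ halfLine ∧ x ∈ A ∧ cumul A x ∈ B}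

/-! ### Weakly thinnable pairs -/

/-- `(F, μ)` is a weakly thinnable pair (WTP). -/
structure IsWTP (F : Set (Set ℝ)) (μ : Set ℝ → ℝ) : Prop where
  pair : IsProbabilityPair halfLine F μ
  subset : F ⊆ intervalSets
  thin_mem : ∀ C ∈ densitySets, ∀ A ∈ F, thin C A ∈ F
  thin_eq : ∀ C ∈ densitySets, ∀ A ∈ F, μ (thin C A) = μ C * μ A
  order : ∀ A ∈ F, ∀ B ∈ F, (∀ x ∈ halfLine, cumul B x ≤ cumul A x) → μ B ≤ μ A
  tail : ∀ c ∈ halfLine, μ (Ici c) = 1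

/-- The collection `WT` of weakly thinnable pairs. -/
def WT : Set (Set (Set ℝ) × (Set ℝ → ℝ)) := {p | IsWTP p.1 p.2}

/-- The collection `WTC` of weakly thinnable pairs `(F, μ)` with `μ` coherent. -/
def WTC : Set (Set (Set ℝ) × (Set ℝ → ℝ)) := {p | p ∈ WT ∧ IsCoherent halfLine p.1 p.2}

/-! ### The pair `(𝓐ᵘⁿⁱ, α)` -/

/-- `σ_A(D, x) = (1/D) ∫_x^{x+D} 1_A(y) dy`. -/
def sigma (A : Set ℝ) (D x : ℝ) : ℝ := (1 / D) * ∫ y in x..(x + D), ind A y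

/-- `U(A) = limsup_{D → ∞} sup_{x ∈ (0,∞)} σ_A(D, x)`. -/
def upperU (A : Set ℝ) : ℝ := limsup (fun D : ℝ => ⨆ x : Ioi (0 : ℝ), sigma A D x) atTop

/-- `L(A) = liminf_{D → ∞} inf_{x ∈ (0,∞)} σ_A(D, x)`. -/
def lowerL (A : Set ℝ) : ℝ := liminf (fun D : ℝ => ⨅ x : Ioi (0 : ℝ), sigma A D x) atTop

/-- `𝓦ᵘⁿⁱ = {A ∈ 𝓜 : L(A) = U(A)}`. -/
def Wuni : Set (Set ℝ) := {A | A ∈ intervalSets ∧ lowerL A = upperU A}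

/-- `log(A) = {log a : a ∈ A ∩ [1, ∞)}`. -/
def logSet (A : Set ℝ) : Set ℝ := Real.log '' (A ∩ Ici 1)

/-- `𝓐ᵘⁿⁱ = {A ∈ 𝓜 : log(A) ∈ 𝓦ᵘⁿⁱ}`. -/
def Auni : Set (Set ℝ) := {A | A ∈ intervalSets ∧ logSet A ∈ Wuni}

/-- `α(A) = λ(log(A))`. -/
def alpha (A : Set ℝ) : ℝ := density (logSet A)

/-- `ξ_A(D, x) = (1/log D) ∫_x^{Dx} ρ_A(y)/y dy`. -/
def xi (A : Set ℝ) (D x : ℝ) : ℝ := (1 / Real.log D) * ∫ y in x..(D * x), rho A y / y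

end WeakThinnability

end

open WeakThinnability

/-!
The theorem rests on the logarithmic variable. Put `logRho A u = ρ_A(e^u)` and average it over windows
`[t, t + T]`: this is `ξ_A(e^T, e^t)` (`xi_eq_mean`), and it differs from the average of `1_{log A}`
over the same window by at most `1 / T`, since `ρ_A(e^u)` has right derivative
`1_A(e^u) - ρ_A(e^u)` (`abs_mean_logRho_sub_le`). So `A ∈ 𝓐ᵘⁿⁱ` means that these averages converge as
`T → ∞`, uniformly in `t > 0`, that is, along the filter `windows`; the limit is then `α(A)`
(`Auni_spec`, `mem_Auni_of_tendsto`).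

Thinning satisfies `S_{C ∘ A} = S_A ∘ S_C` (`cumul_thin`), so thinning by a set of density `l > 0` acts
asymptotically on `logRho A` as a translation by `log l` followed by multiplication by `l`. Long
averages do not see the translation (`tendsto_mean_logRho_thin`). Hence along every filter finer than
`windows` the limits of the averages form a coherent weakly thinnable pair
(`mem_WTC_of_tendsto_mean`). The filter `windows` itself gives `(𝓐ᵘⁿⁱ, α)`; an ultrafilter gives a
pair on all of `𝓜`, which is the extension `𝓤-lim ξ_A(s_n, f_n)`.

Conversely let `(F, μ)` be any weakly thinnable pair. Comparison with periodic sets shows that `μ`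
extends natural density (`IsWTP.eq_density`). For `A ∈ F`, a disjoint union of thinnings
`D_i ∘ A`, with densities proportional to `1, 1/2, …, 1/N`, has the same measure as `A`, but its
relative length `ρ` is nearly a logarithmic average of `A`, so order comparison with a periodic set
gives `μ(A) ≤ U(log A)` (`IsWTP.le_of_mean_le`); complements give `L(log A) ≤ μ(A)`. This proves that
`(𝓐ᵘⁿⁱ, α)` is canonical. It is maximal because a set measured by a canonical pair has the same
limit along all ultrafilters of windows, so its averages converge along `windows`.
-/

open Set Filter Topology MeasureTheory

namespace WeakThinnability

/-! ### A local description of `𝓜` and its closure properties -/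

/-- `A ⊆ [0, ∞)` and, near each point, membership in `A` is constant on a right neighbourhood and
on a punctured left neighbourhood. This is the local form of membership in `𝓜`. -/
structure IsStepSet (A : Set ℝ) : Prop where
  nonneg : ∀ y ∈ A, 0 ≤ y
  right : ∀ x, ∀ᶠ y in 𝓝[≥] x, (y ∈ A ↔ x ∈ A)
  left : ∀ x, ∃ p : Prop, ∀ᶠ y in 𝓝[<] x, (y ∈ A ↔ p)

theorem exists_mem_Ico_succ {a : ℕ → ℝ} (ht : Tendsto a atTop atTop) {x : ℝ} (hx : a 0 ≤ x) :
    ∃ k, x ∈ Ico (a k) (a (k + 1)) := by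
  classical
  have hex : ∃ n, x < a n := (ht.eventually_gt_atTop x).exists
  have h0 : Nat.find hex ≠ 0 := fun h => by
    have := Nat.find_spec hex
    rw [h] at this
    exact absurd this (not_lt.2 hx)
  obtain ⟨k, hk⟩ := Nat.exists_eq_succ_of_ne_zero h0
  refine ⟨k, not_lt.1 (Nat.find_min hex (hk ▸ Nat.lt_succ_self k)), ?_⟩
  have := Nat.find_spec hex
  rwa [hk] at this

theorem exists_mem_Ioc_succ {a : ℕ → ℝ} (ht : Tendsto a atTop atTop) {x : ℝ} (hx : a 0 < x) :
    ∃ k, x ∈ Ioc (a k) (a (k + 1)) := by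
  classical
  have hex : ∃ n, x ≤ a n := (ht.eventually_ge_atTop x).exists
  have h0 : Nat.find hex ≠ 0 := fun h => by
    have := Nat.find_spec hex
    rw [h] at this
    exact absurd hx (not_lt.2 this)
  obtain ⟨k, hk⟩ := Nat.exists_eq_succ_of_ne_zero h0
  refine ⟨k, not_le.1 (Nat.find_min hex (hk ▸ Nat.lt_succ_self k)), ?_⟩
  have := Nat.find_spec hex
  rwa [hk] at this

theorem mem_iUnion_Ico_iff_even {a : ℕ → ℝ} (hm : Monotone a) {k : ℕ} {x : ℝ}
    (hx : x ∈ Ico (a k) (a (k + 1))) : x ∈ ⋃ i : ℕ, Ico (a (2 * i)) (a (2 * i + 1)) ↔ Even k := by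
  constructor
  · intro h
    obtain ⟨i, hi⟩ := mem_iUnion.1 h
    have h1 : 2 * i < k + 1 := hm.reflect_lt (hi.1.trans_lt hx.2)
    have h2 : k < 2 * i + 1 := hm.reflect_lt (hx.1.trans_lt hi.2)
    exact ⟨i, by omega⟩
  · rintro ⟨i, rfl⟩
    exact mem_iUnion.2 ⟨i, by rwa [two_mul]⟩

theorem isStepSet_of_mem {A : Set ℝ} (hA : A ∈ intervalSets) : IsStepSet A := by
  obtain ⟨a, h0, hm, ht, rfl⟩ := hA
  have hge : ∀ y ∈ ⋃ i : ℕ, Ico (a (2 * i)) (a (2 * i + 1)), a 0 ≤ y := by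
    intro y hy
    obtain ⟨i, hi⟩ := mem_iUnion.1 hy
    exact (hm (Nat.zero_le _)).trans hi.1
  refine ⟨fun y hy => h0.trans (hge y hy), fun x => ?_, fun x => ?_⟩
  · rcases lt_or_ge x (a 0) with hx | hx
    · filter_upwards [mem_nhdsWithin_of_mem_nhds (Iio_mem_nhds hx)] with y hy
      exact iff_of_false (fun h => absurd (hge y h) (not_le.2 hy))
        (fun h => absurd (hge x h) (not_le.2 hx))
    · obtain ⟨k, hk⟩ := exists_mem_Ico_succ ht hx
      filter_upwards [Ico_mem_nhdsGE hk.2] with y hy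
      rw [mem_iUnion_Ico_iff_even hm hk, mem_iUnion_Ico_iff_even hm ⟨hk.1.trans hy.1, hy.2⟩]
  · rcases le_or_gt x (a 0) with hx | hx
    · refine ⟨False, ?_⟩
      filter_upwards [self_mem_nhdsWithin] with y hy
      exact iff_of_false (fun h => absurd (hge y h) (not_le.2 (lt_of_lt_of_le hy hx))) id
    · obtain ⟨k, hk⟩ := exists_mem_Ioc_succ ht hx
      refine ⟨Even k, ?_⟩
      filter_upwards [Ioo_mem_nhdsLT hk.1] with y hy
      exact mem_iUnion_Ico_iff_even hm ⟨hy.1.le, hy.2.trans_le hk.2⟩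

/-- The greedy sequence of switching points of `A`: the next term is the first point at which
membership in `A` differs from the parity of the index, but at most one unit ahead. -/
noncomputable def switchSeq (A : Set ℝ) : ℕ → ℝ
  | 0 => 0
  | k + 1 => sInf ({x | switchSeq A k ≤ x ∧ ¬ (x ∈ A ↔ Even k)} ∪ {switchSeq A k + 1})

theorem switchSeq_le_of_mem {A : Set ℝ} {k : ℕ} {b : ℝ} (hb : b ≤ switchSeq A k + 1)
    (h : ∀ x, switchSeq A k ≤ x → x < b → (x ∈ A ↔ Even k)) : b ≤ switchSeq A (k + 1) := by
  refine le_csInf ⟨_, Or.inr rfl⟩ ?_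
  rintro x (⟨h1, h2⟩ | rfl)
  · by_contra hlt
    exact h2 (h x h1 (not_le.1 hlt))
  · exact hb

theorem switchSeq_mono (A : Set ℝ) : Monotone (switchSeq A) :=
  monotone_nat_of_le_succ fun k =>
    switchSeq_le_of_mem (by linarith) fun _ h1 h2 => absurd h1 (not_le.2 h2)

theorem mem_iff_even_of_switchSeq {A : Set ℝ} {k : ℕ} {x : ℝ}
    (hx : x ∈ Ico (switchSeq A k) (switchSeq A (k + 1))) : x ∈ A ↔ Even k := by
  by_contra h
  refine absurd hx.2 (not_lt.2 (csInf_le ⟨switchSeq A k, ?_⟩ (Or.inl ⟨hx.1, h⟩)))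
  rintro y (hy | rfl)
  · exact hy.1
  · linarith

theorem switchSeq_tendsto {A : Set ℝ} (hA : IsStepSet A) : Tendsto (switchSeq A) atTop atTop := by
  rcases tendsto_atTop_of_monotone (switchSeq_mono A) with h | ⟨L, hL⟩
  · exact h
  exfalso
  have hle : ∀ k, switchSeq A k ≤ L := fun k => (switchSeq_mono A).ge_of_tendsto hL k
  -- One of two consecutive indices has the parity that matches a locally constant value.
  have step : ∀ (b c : ℝ) (p : Prop), c ≤ b + 1 → (∀ x, b ≤ x → x < c → (x ∈ A ↔ p)) →
      ∀ k, b ≤ switchSeq A k → c ≤ switchSeq A (k + 2) := by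
    intro b c p hc hp k hk
    by_cases hpk : p ↔ Even k
    · refine le_trans (switchSeq_le_of_mem (by linarith) fun x h1 h2 => ?_)
        (switchSeq_mono A (Nat.le_succ _))
      rw [hp x (hk.trans h1) h2, hpk]
    · have hk1 : b ≤ switchSeq A (k + 1) := hk.trans (switchSeq_mono A (Nat.le_succ _))
      refine switchSeq_le_of_mem (by linarith) fun x h1 h2 => ?_
      rw [hp x (hk1.trans h1) h2, Nat.even_add_one]
      tauto
  obtain ⟨p, hp⟩ := hA.left L
  obtain ⟨l, hl, hl'⟩ := (mem_nhdsLT_iff_exists_Ioo_subset).1 hp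
  obtain ⟨k, hk⟩ := (hL.eventually (lt_mem_nhds (show max l (L - 1) < L from
    max_lt hl (by linarith)))).exists
  have h1 := step (switchSeq A k) L p (by linarith [(le_max_right l (L - 1)).trans_lt hk])
    (fun x h1 h2 => hl' ⟨((le_max_left _ _).trans_lt hk).trans_le h1, h2⟩) k le_rfl
  obtain ⟨u, hu, hu'⟩ := (mem_nhdsGE_iff_exists_Ico_subset).1 (hA.right L)
  have h2 := step L (min u (L + 1)) (L ∈ A) (min_le_right _ _)
    (fun x h1 h2 => hu' ⟨h1, h2.trans_le (min_le_left _ _)⟩) (k + 2) h1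
  have h3 : L < min u (L + 1) := lt_min hu (by linarith)
  linarith [hle (k + 2 + 2)]

theorem mem_intervalSets_iff {A : Set ℝ} : A ∈ intervalSets ↔ IsStepSet A := by
  refine ⟨isStepSet_of_mem, fun hA => ⟨switchSeq A, le_rfl, switchSeq_mono A,
    switchSeq_tendsto hA, ?_⟩⟩
  ext x
  rcases lt_or_ge x 0 with hx | hx
  · refine iff_of_false (fun h => absurd (hA.nonneg x h) (not_le.2 hx)) fun h => ?_
    obtain ⟨i, hi⟩ := mem_iUnion.1 h
    exact absurd ((switchSeq_mono A (Nat.zero_le _)).trans hi.1) (not_le.2 hx)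
  · obtain ⟨k, hk⟩ := exists_mem_Ico_succ (switchSeq_tendsto hA) (x := x) hx
    rw [mem_iUnion_Ico_iff_even (switchSeq_mono A) hk, mem_iff_even_of_switchSeq hk]

theorem IsStepSet.union {A B : Set ℝ} (hA : IsStepSet A) (hB : IsStepSet B) :
    IsStepSet (A ∪ B) := by
  refine ⟨fun y hy => hy.elim (hA.nonneg y) (hB.nonneg y), fun x => ?_, fun x => ?_⟩
  · filter_upwards [hA.right x, hB.right x] with y h1 h2
    rw [mem_union, mem_union, h1, h2]
  · obtain ⟨p, hp⟩ := hA.left x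
    obtain ⟨q, hq⟩ := hB.left x
    refine ⟨p ∨ q, ?_⟩
    filter_upwards [hp, hq] with y h1 h2
    rw [mem_union, h1, h2]

theorem IsStepSet.inter {A B : Set ℝ} (hA : IsStepSet A) (hB : IsStepSet B) :
    IsStepSet (A ∩ B) := by
  refine ⟨fun y hy => hA.nonneg y hy.1, fun x => ?_, fun x => ?_⟩
  · filter_upwards [hA.right x, hB.right x] with y h1 h2
    rw [mem_inter_iff, mem_inter_iff, h1, h2]
  · obtain ⟨p, hp⟩ := hA.left x
    obtain ⟨q, hq⟩ := hB.left x
    refine ⟨p ∧ q, ?_⟩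
    filter_upwards [hp, hq] with y h1 h2
    rw [mem_inter_iff, h1, h2]

theorem isStepSet_Ici {c : ℝ} (hc : 0 ≤ c) : IsStepSet (Ici c) := by
  refine ⟨fun y hy => hc.trans hy, fun x => ?_, fun x => ?_⟩
  · rcases lt_or_ge x c with hx | hx
    · filter_upwards [mem_nhdsWithin_of_mem_nhds (Iio_mem_nhds hx)] with y hy
      exact iff_of_false (fun h => absurd (mem_Iio.1 hy) (not_lt.2 h))
        (fun h => absurd hx (not_lt.2 h))
    · filter_upwards [self_mem_nhdsWithin] with y hy
      exact iff_of_true (hx.trans hy) hx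
  · rcases le_or_gt x c with hx | hx
    · refine ⟨False, ?_⟩
      filter_upwards [self_mem_nhdsWithin] with y hy
      exact iff_of_false (fun h => absurd (lt_of_lt_of_le hy hx) (not_lt.2 h)) id
    · refine ⟨True, ?_⟩
      filter_upwards [Ioo_mem_nhdsLT hx] with y hy
      exact iff_of_true hy.1.le trivial

theorem isStepSet_halfLine : IsStepSet halfLine := isStepSet_Ici le_rfl

theorem IsStepSet.compl {A : Set ℝ} (hA : IsStepSet A) : IsStepSet (halfLine \ A) := by
  refine ⟨fun y hy => hy.1, fun x => ?_, fun x => ?_⟩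
  · filter_upwards [isStepSet_halfLine.right x, hA.right x] with y h1 h2
    rw [Set.mem_sdiff, Set.mem_sdiff, h1, h2]
  · obtain ⟨p, hp⟩ := isStepSet_halfLine.left x
    obtain ⟨q, hq⟩ := hA.left x
    refine ⟨p ∧ ¬ q, ?_⟩
    filter_upwards [hp, hq] with y h1 h2
    rw [Set.mem_sdiff, h1, h2]

theorem mem_logSet {A : Set ℝ} {u : ℝ} : u ∈ logSet A ↔ 0 ≤ u ∧ Real.exp u ∈ A := by
  constructor
  · rintro ⟨a, ⟨ha, h1⟩, rfl⟩
    have h1 : (1 : ℝ) ≤ a := h1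
    exact ⟨Real.log_nonneg h1, by rwa [Real.exp_log (by linarith)]⟩
  · rintro ⟨h0, h⟩
    exact ⟨Real.exp u, ⟨h, Real.one_le_exp h0⟩, Real.log_exp u⟩

theorem IsStepSet.logSet {A : Set ℝ} (hA : IsStepSet A) : IsStepSet (logSet A) := by
  refine ⟨fun y hy => (mem_logSet.1 hy).1, fun x => ?_, fun x => ?_⟩
  · have ht : Tendsto Real.exp (𝓝[≥] x) (𝓝[≥] (Real.exp x)) :=
      tendsto_nhdsWithin_of_tendsto_nhds_of_eventually_within _
        (Real.continuous_exp.continuousAt.mono_left nhdsWithin_le_nhds)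
        (by filter_upwards [self_mem_nhdsWithin] with y hy using Real.exp_le_exp.2 hy)
    filter_upwards [isStepSet_halfLine.right x, ht.eventually (hA.right _)] with y h1 h2
    rw [mem_logSet, mem_logSet, h2]
    exact and_congr_left fun _ => h1
  · have ht : Tendsto Real.exp (𝓝[<] x) (𝓝[<] (Real.exp x)) :=
      tendsto_nhdsWithin_of_tendsto_nhds_of_eventually_within _
        (Real.continuous_exp.continuousAt.mono_left nhdsWithin_le_nhds)
        (by filter_upwards [self_mem_nhdsWithin] with y hy using Real.exp_lt_exp.2 hy)
    obtain ⟨p, hp⟩ := isStepSet_halfLine.left x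
    obtain ⟨q, hq⟩ := hA.left (Real.exp x)
    refine ⟨p ∧ q, ?_⟩
    filter_upwards [hp, ht.eventually hq] with y h1 h2
    rw [mem_logSet, h2]
    exact and_congr_left fun _ => h1

theorem IsStepSet.measurableSet {A : Set ℝ} (hA : IsStepSet A) : MeasurableSet A := by
  obtain ⟨a, -, -, -, rfl⟩ := mem_intervalSets_iff.2 hA
  exact MeasurableSet.iUnion fun _ => measurableSet_Ico

/-! ### Cumulative length and thinning -/

theorem cumul_of_nonpos (A : Set ℝ) {x : ℝ} (hx : x ≤ 0) : cumul A x = 0 := by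
  simp [cumul, Ico_eq_empty (not_lt.2 hx)]

theorem cumul_nonneg (A : Set ℝ) (x : ℝ) : 0 ≤ cumul A x := ENNReal.toReal_nonneg

theorem volume_inter_Ico_ne_top (A : Set ℝ) (x y : ℝ) : volume (A ∩ Ico x y) ≠ ⊤ :=
  ne_top_of_le_ne_top (by simp) (measure_mono inter_subset_right)

theorem cumul_mono (A : Set ℝ) : Monotone (cumul A) := fun _ _ h =>
  ENNReal.toReal_mono (volume_inter_Ico_ne_top _ _ _)
    (measure_mono (inter_subset_inter_right _ (Ico_subset_Ico_right h)))

theorem ind_nonneg (A : Set ℝ) (x : ℝ) : 0 ≤ ind A x :=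
  indicator_nonneg (fun _ _ => zero_le_one) x

theorem ind_le_one (A : Set ℝ) (x : ℝ) : ind A x ≤ 1 :=
  indicator_le' (fun _ _ => le_rfl) (fun _ _ => zero_le_one) x

theorem ind_of_mem {A : Set ℝ} {x : ℝ} (h : x ∈ A) : ind A x = 1 := indicator_of_mem h _

theorem ind_of_notMem {A : Set ℝ} {x : ℝ} (h : x ∉ A) : ind A x = 0 := indicator_of_notMem h _

theorem intervalIntegrable_ind {A : Set ℝ} (hA : MeasurableSet A) (a b : ℝ) :
    IntervalIntegrable (ind A) volume a b := by
  rw [intervalIntegrable_iff]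
  exact (integrableOn_const (by simp)).indicator hA

theorem cumul_eq_integral {A : Set ℝ} (hA : MeasurableSet A) {x : ℝ} (hx : 0 ≤ x) :
    cumul A x = ∫ y in (0 : ℝ)..x, ind A y := by
  rw [intervalIntegral.integral_of_le hx, integral_Ioc_eq_integral_Ioo,
    ← integral_Ico_eq_integral_Ioo, ind, setIntegral_indicator hA, inter_comm]
  simp [cumul, measureReal_def]

theorem cumul_sub {A : Set ℝ} (hA : MeasurableSet A) {x y : ℝ} (hx : 0 ≤ x) (hy : 0 ≤ y) :
    cumul A y - cumul A x = ∫ u in x..y, ind A u := by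
  rw [cumul_eq_integral hA hx, cumul_eq_integral hA hy,
    intervalIntegral.integral_interval_sub_left] <;> exact intervalIntegrable_ind hA _ _

theorem cumul_sub_le (A : Set ℝ) {x y : ℝ} (hxy : x ≤ y) : cumul A y ≤ cumul A x + (y - x) := by
  have h : A ∩ Ico 0 y ⊆ A ∩ Ico 0 x ∪ Ico x y := fun u hu => by
    rcases lt_or_ge u x with h | h
    · exact Or.inl ⟨hu.1, hu.2.1, h⟩
    · exact Or.inr ⟨h, hu.2.2⟩
  have h1 : volume (A ∩ Ico 0 y) ≤ volume (A ∩ Ico 0 x) + volume (Ico x y) :=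
    (measure_mono h).trans (measure_union_le _ _)
  have h2 := ENNReal.toReal_mono (by simp [volume_inter_Ico_ne_top]) h1
  rwa [ENNReal.toReal_add (volume_inter_Ico_ne_top _ _ _) (by simp), Real.volume_Ico,
    ENNReal.toReal_ofReal (by linarith)] at h2

theorem abs_cumul_sub_le (A : Set ℝ) (x y : ℝ) : |cumul A x - cumul A y| ≤ |x - y| := by
  rcases le_total x y with h | h
  · rw [abs_sub_comm, abs_sub_comm x, abs_of_nonneg (sub_nonneg.2 (cumul_mono A h)),
      abs_of_nonneg (sub_nonneg.2 h)]
    linarith [cumul_sub_le A h]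
  · rw [abs_of_nonneg (sub_nonneg.2 (cumul_mono A h)), abs_of_nonneg (sub_nonneg.2 h)]
    linarith [cumul_sub_le A h]

theorem cumul_le_self (A : Set ℝ) {x : ℝ} (hx : 0 ≤ x) : cumul A x ≤ x := by
  have := cumul_sub_le A hx
  rw [cumul_of_nonpos A le_rfl] at this
  linarith

theorem continuous_cumul (A : Set ℝ) : Continuous (cumul A) := by
  refine (LipschitzWith.of_dist_le_mul (K := 1) fun x y => ?_).continuous
  simpa [Real.dist_eq] using abs_cumul_sub_le A x y

theorem cumul_union {A B : Set ℝ} (hB : MeasurableSet B) (h : A ∩ B = ∅) (x : ℝ) :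
    cumul (A ∪ B) x = cumul A x + cumul B x := by
  rw [cumul, union_inter_distrib_right, measure_union _ (hB.inter measurableSet_Ico),
    ENNReal.toReal_add (volume_inter_Ico_ne_top _ _ _) (volume_inter_Ico_ne_top _ _ _)]
  · rfl
  · exact (disjoint_iff_inter_eq_empty.2 h).mono inter_subset_left inter_subset_left

theorem cumul_halfLine {x : ℝ} (hx : 0 ≤ x) : cumul halfLine x = x := by
  have : halfLine ∩ Ico 0 x = Ico 0 x := inter_eq_right.2 fun y hy => hy.1
  rw [cumul, this, Real.volume_Ico, sub_zero, ENNReal.toReal_ofReal hx]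

theorem cumul_compl {A : Set ℝ} (hA : IsStepSet A) {x : ℝ} (hx : 0 ≤ x) :
    cumul (halfLine \ A) x = x - cumul A x := by
  have h := cumul_union hA.compl.measurableSet (disjoint_iff_inter_eq_empty.1
    (disjoint_sdiff_right (s := A) (t := halfLine))) x
  have hsub : A ⊆ halfLine := hA.nonneg
  rw [union_sdiff_cancel hsub, cumul_halfLine hx] at h
  linarith

theorem rho_eq {A : Set ℝ} (hA : MeasurableSet A) {x : ℝ} (hx : 0 ≤ x) :
    rho A x = cumul A x / x := by
  rw [rho, cumul_eq_integral hA hx]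
  ring

/-- The function `S_C` maps Lebesgue measure on `C ∩ [0, x)` to Lebesgue measure on
`[0, S_C(x))`. -/
theorem map_cumul_restrict (C : Set ℝ) (x : ℝ) :
    (volume.restrict (C ∩ Ico 0 x)).map (cumul C) = volume.restrict (Ico 0 (cumul C x)) := by
  have hc := continuous_cumul C
  have : IsFiniteMeasure (volume.restrict (C ∩ Ico 0 x)) :=
    ⟨by simpa using (volume_inter_Ico_ne_top C 0 x).lt_top⟩
  have hvol : ∀ z, volume (C ∩ Ico 0 z) = ENNReal.ofReal (cumul C z) := fun z =>
    (ENNReal.ofReal_toReal (volume_inter_Ico_ne_top _ _ _)).symm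
  refine Measure.ext_of_Iic _ _ fun u => ?_
  rw [Measure.map_apply hc.measurable measurableSet_Iic,
    Measure.restrict_apply (hc.measurable measurableSet_Iic),
    Measure.restrict_apply measurableSet_Iic]
  rcases lt_or_ge u 0 with hu | hu
  · have h1 : cumul C ⁻¹' Iic u = ∅ :=
      eq_empty_of_forall_notMem fun y hy => absurd (cumul_nonneg C y) (not_le.2 (hy.trans_lt hu))
    have h2 : Iic u ∩ Ico 0 (cumul C x) = ∅ :=
      eq_empty_of_forall_notMem fun y hy => absurd (hy.2.1.trans hy.1) (not_le.2 hu)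
    rw [h1, h2, empty_inter]
  rcases le_or_gt (cumul C x) u with hux | hux
  · have h1 : cumul C ⁻¹' Iic u ∩ (C ∩ Ico 0 x) = C ∩ Ico 0 x :=
      inter_eq_right.2 fun y hy => (cumul_mono C hy.2.2.le).trans hux
    have h2 : Iic u ∩ Ico 0 (cumul C x) = Ico 0 (cumul C x) :=
      inter_eq_right.2 fun y hy => hy.2.le.trans hux
    rw [h1, h2, hvol, Real.volume_Ico, sub_zero]
  · have hx : 0 < x := by
      by_contra hx
      rw [cumul_of_nonpos C (not_lt.1 hx)] at hux
      linarith
    -- `z` is the last point of `[0, x]` at which the cumulative length is at most `u`.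
    obtain ⟨z, ⟨⟨hz0, hzx⟩, hzu⟩, hmax⟩ :=
      (isCompact_Icc.inter_right (isClosed_Iic.preimage hc) :
        IsCompact (Icc 0 x ∩ cumul C ⁻¹' Iic u)).exists_isGreatest
        ⟨0, ⟨le_rfl, hx.le⟩, by simpa [cumul_of_nonpos] using hu⟩
    have hzu : cumul C z ≤ u := hzu
    have hz : cumul C z = u := by
      obtain ⟨w, hw, hwu⟩ := intermediate_value_Icc hzx hc.continuousOn ⟨hzu, hux.le⟩
      have hwz : w ≤ z := hmax ⟨⟨hz0.trans hw.1, hw.2⟩, hwu.le⟩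
      rw [← hwu, le_antisymm hwz hw.1]
    have h2 : Iic u ∩ Ico 0 (cumul C x) = Icc 0 u := by
      ext y
      exact ⟨fun h => ⟨h.2.1, h.1⟩, fun h => ⟨h.2, h.1, lt_of_le_of_lt h.2 hux⟩⟩
    have hzx' : z < x := lt_of_le_of_ne hzx fun h => by rw [← h, hz] at hux; exact lt_irrefl _ hux
    have h1 : cumul C ⁻¹' Iic u ∩ (C ∩ Ico 0 x) = C ∩ Icc 0 z := by
      ext y
      refine ⟨fun h => ⟨h.2.1, h.2.2.1, hmax ⟨⟨h.2.2.1, h.2.2.2.le⟩, h.1⟩⟩, fun h => ?_⟩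
      exact ⟨(cumul_mono C h.2.2).trans hzu, h.1, h.2.1, h.2.2.trans_lt hzx'⟩
    have h3 : volume (C ∩ Icc 0 z) = volume (C ∩ Ico 0 z) :=
      measure_congr ((ae_eq_refl C).inter Ico_ae_eq_Icc.symm)
    rw [h1, h2, h3, hvol, hz, Real.volume_Icc, sub_zero]

/-- Lengths compose under thinning: `S_{C ∘ A} = S_A ∘ S_C`. -/
theorem cumul_thin (C : Set ℝ) {A : Set ℝ} (hA : MeasurableSet A) (x : ℝ) :
    cumul (thin C A) x = cumul A (cumul C x) := by
  have h : thin C A ∩ Ico 0 x = cumul C ⁻¹' A ∩ (C ∩ Ico 0 x) := by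
    ext y
    constructor
    · rintro ⟨⟨_, h2, h3⟩, h4⟩
      exact ⟨h3, h2, h4⟩
    · rintro ⟨h3, h2, h4⟩
      exact ⟨⟨h4.1, h2, h3⟩, h4⟩
  have hm := (continuous_cumul C).measurable
  rw [cumul, h, ← Measure.restrict_apply (hm hA), ← Measure.map_apply hm hA, map_cumul_restrict,
    Measure.restrict_apply hA]
  rfl

theorem IsStepSet.thin {C A : Set ℝ} (hC : IsStepSet C) (hA : IsStepSet A) :
    IsStepSet (thin C A) := by
  refine ⟨fun y hy => hy.1, fun x => ?_, fun x => ?_⟩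
  · have ht : Tendsto (cumul C) (𝓝[≥] x) (𝓝[≥] (cumul C x)) :=
      tendsto_nhdsWithin_of_tendsto_nhds_of_eventually_within _
        ((continuous_cumul C).continuousAt.mono_left nhdsWithin_le_nhds)
        (by filter_upwards [self_mem_nhdsWithin] with y hy using cumul_mono C hy)
    filter_upwards [isStepSet_halfLine.right x, hC.right x, ht.eventually (hA.right _)]
      with y h1 h2 h3
    exact and_congr h1 (and_congr h2 h3)
  · obtain ⟨p, hp⟩ := isStepSet_halfLine.left x
    obtain ⟨q, hq⟩ := hC.left x
    obtain ⟨r, hr⟩ := hA.left (cumul C x)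
    by_cases hq' : q
    · obtain ⟨l, hl, hl'⟩ := (mem_nhdsLT_iff_exists_Ioo_subset).1 hq
      rcases le_or_gt x 0 with hx | hx
      · refine ⟨False, ?_⟩
        filter_upwards [self_mem_nhdsWithin] with y hy
        exact iff_of_false (fun h => absurd (lt_of_lt_of_le hy hx) (not_lt.2 h.1)) id
      -- `C` contains a left neighbourhood of `x`, so `S_C` is strictly increasing there.
      have ht : Tendsto (cumul C) (𝓝[<] x) (𝓝[<] (cumul C x)) := by
        refine tendsto_nhdsWithin_of_tendsto_nhds_of_eventually_within _
          ((continuous_cumul C).continuousAt.mono_left nhdsWithin_le_nhds) ?_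
        filter_upwards [Ioo_mem_nhdsLT (max_lt hl hx)] with y hy
        have hy0 : 0 < y := (le_max_right _ _).trans_lt hy.1
        have h1 := cumul_sub hC.measurableSet hy0.le hx.le
        have h2 : ∫ u in y..x, ind C u = ∫ u in y..x, (1 : ℝ) := by
          rw [intervalIntegral.integral_of_le hy.2.le, intervalIntegral.integral_of_le hy.2.le,
            integral_Ioc_eq_integral_Ioo, integral_Ioc_eq_integral_Ioo]
          refine setIntegral_congr_fun measurableSet_Ioo fun u hu => ?_
          exact ind_of_mem ((hl' ⟨((le_max_left _ _).trans_lt hy.1).trans hu.1, hu.2⟩).2 hq')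
        rw [h2, intervalIntegral.integral_const, smul_eq_mul, mul_one] at h1
        exact mem_Iio.2 (by linarith [hy.2])
      refine ⟨p ∧ q ∧ r, ?_⟩
      filter_upwards [hp, hq, ht.eventually hr] with y h1 h2 h3
      exact and_congr h1 (and_congr h2 h3)
    · refine ⟨False, ?_⟩
      filter_upwards [hq] with y hy
      exact iff_of_false (fun h => hq' (hy.1 h.2.1)) id

theorem thin_halfLine {C : Set ℝ} (hC : IsStepSet C) : thin C halfLine = C := by
  ext y
  exact ⟨fun h => h.2.1, fun h => ⟨hC.nonneg y h, h, cumul_nonneg C y⟩⟩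

/-! ### Logarithmic averages -/

/-- The average of `h` over the window `[t, t + T]`, where `p = (T, t)`. -/
noncomputable def mean (h : ℝ → ℝ) (p : ℝ × ℝ) : ℝ := (1 / p.1) * ∫ u in p.2..(p.2 + p.1), h u

/-- `ρ_A` in the logarithmic variable, `u ↦ ρ_A(e^u)`. -/
noncomputable def logRho (A : Set ℝ) (u : ℝ) : ℝ := cumul A (Real.exp u) / Real.exp u

/-- The filter of windows `(T, t)` with `T → ∞`, uniformly in the starting point `t > 0`. -/
def windows : Filter (ℝ × ℝ) := atTop ×ˢ 𝓟 (Ioi 0)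

theorem logRho_nonneg (A : Set ℝ) (u : ℝ) : 0 ≤ logRho A u :=
  div_nonneg (cumul_nonneg _ _) (Real.exp_pos u).le

theorem logRho_le_one (A : Set ℝ) (u : ℝ) : logRho A u ≤ 1 :=
  div_le_one_of_le₀ (cumul_le_self A (Real.exp_pos u).le) (Real.exp_pos u).le

theorem abs_logRho_le_one (A : Set ℝ) (u : ℝ) : |logRho A u| ≤ 1 := by
  rw [abs_of_nonneg (logRho_nonneg A u)]
  exact logRho_le_one A u

theorem continuous_logRho (A : Set ℝ) : Continuous (logRho A) :=
  ((continuous_cumul A).comp Real.continuous_exp).div Real.continuous_exp fun u =>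
    (Real.exp_pos u).ne'

theorem logRho_union {A B : Set ℝ} (hB : MeasurableSet B) (h : A ∩ B = ∅) (u : ℝ) :
    logRho (A ∪ B) u = logRho A u + logRho B u := by
  rw [logRho, cumul_union hB h, add_div]
  rfl

theorem logRho_compl {A : Set ℝ} (hA : IsStepSet A) (u : ℝ) :
    logRho (halfLine \ A) u = 1 - logRho A u := by
  rw [logRho, cumul_compl hA (Real.exp_pos u).le, sub_div, div_self (Real.exp_pos u).ne']
  rfl

theorem xi_eq_mean {A : Set ℝ} (hA : MeasurableSet A) {D x : ℝ} (hD : 0 < D) (hx : 0 < x) :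
    xi A D x = mean (logRho A) (Real.log D, Real.log x) := by
  have hcont : ContinuousOn (fun y => rho A y / y)
      (Real.exp '' uIcc (Real.log x) (Real.log x + Real.log D)) := by
    have : ContinuousOn (fun y => cumul A y / y / y) (Ioi 0) :=
      ((continuous_cumul A).continuousOn.div continuousOn_id fun y hy => ne_of_gt hy).div
        continuousOn_id fun y hy => ne_of_gt hy
    refine (this.congr fun y hy => ?_).mono ?_
    · simp only [rho_eq hA (le_of_lt hy)]
    · rintro _ ⟨u, -, rfl⟩
      exact Real.exp_pos u
  have h := intervalIntegral.integral_comp_mul_deriv'' (a := Real.log x)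
    (b := Real.log x + Real.log D) Real.continuous_exp.continuousOn
    (fun u _ => (Real.hasDerivAt_exp u).hasDerivWithinAt) Real.continuous_exp.continuousOn hcont
  rw [Real.exp_add, Real.exp_log hx, Real.exp_log hD, mul_comm x D] at h
  rw [xi, mean, ← h]
  congr 1
  refine intervalIntegral.integral_congr fun u _ => ?_
  have hu := (Real.exp_pos u).ne'
  simp only [Function.comp, rho_eq hA (Real.exp_pos u).le, logRho]
  field_simp

theorem hasDerivWithinAt_cumul {A : Set ℝ} (hA : IsStepSet A) {x : ℝ} (hx : 0 < x) :
    HasDerivWithinAt (cumul A) (ind A x) (Ioi x) x := by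
  have hc : ContinuousWithinAt (ind A) (Ioi x) x := by
    have h : ind A =ᶠ[𝓝[>] x] fun _ => ind A x := by
      filter_upwards [nhdsWithin_mono x Ioi_subset_Ici_self (hA.right x)] with y hy
      by_cases h : x ∈ A
      · rw [ind_of_mem h, ind_of_mem (hy.2 h)]
      · rw [ind_of_notMem h, ind_of_notMem fun h' => h (hy.1 h')]
    exact tendsto_const_nhds.congr' h.symm
  have hm : StronglyMeasurableAtFilter (ind A) (𝓝[>] x) volume :=
    (measurable_const.indicator hA.measurableSet).stronglyMeasurable.stronglyMeasurableAtFilter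
  refine ((intervalIntegral.integral_hasDerivWithinAt_right
    (intervalIntegrable_ind hA.measurableSet 0 x) (s := Ici x) hm hc).mono
      Ioi_subset_Ici_self).congr (fun y hy => ?_) ?_
  · exact cumul_eq_integral hA.measurableSet (hx.le.trans (le_of_lt hy))
  · exact cumul_eq_integral hA.measurableSet hx.le

/-- Averaging `1_A` and averaging `ρ_A` on the logarithmic scale is asymptotically the same, because
`ρ_A(e^u)` has right derivative `1_A(e^u) - ρ_A(e^u)`. -/
theorem abs_mean_logRho_sub_le {A : Set ℝ} (hA : IsStepSet A) {T t : ℝ} (hT : 0 < T)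
    (ht : 0 ≤ t) : |mean (logRho A) (T, t) - mean (ind (logSet A)) (T, t)| ≤ 1 / T := by
  have htT : t ≤ t + T := by linarith
  have hd : ∀ u ∈ Ioo (min t (t + T)) (max t (t + T)),
      HasDerivWithinAt (logRho A) (ind (logSet A) u - logRho A u) (Ioi u) u := by
    intro u hu
    rw [min_eq_left htT] at hu
    have hu0 : 0 ≤ u := ht.trans hu.1.le
    have he := Real.exp_pos u
    have h1 : HasDerivWithinAt (fun v => cumul A (Real.exp v)) (ind A (Real.exp u) * Real.exp u)
        (Ioi u) u :=
      (hasDerivWithinAt_cumul hA he).comp u (Real.hasDerivAt_exp u).hasDerivWithinAt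
        fun v hv => Real.exp_lt_exp.2 hv
    have h2 := h1.div (Real.hasDerivAt_exp u).hasDerivWithinAt he.ne'
    refine h2.congr_deriv ?_
    have h3 : ind (logSet A) u = ind A (Real.exp u) := by
      by_cases h : Real.exp u ∈ A
      · rw [ind_of_mem h, ind_of_mem (mem_logSet.2 ⟨hu0, h⟩)]
      · rw [ind_of_notMem h, ind_of_notMem fun h' => h (mem_logSet.1 h').2]
    rw [h3, logRho]
    field_simp
  have hi1 := intervalIntegrable_ind hA.logSet.measurableSet t (t + T)
  have hi2 := (continuous_logRho A).intervalIntegrable (μ := volume) t (t + T)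
  have h := intervalIntegral.integral_eq_sub_of_hasDeriv_right
    (continuous_logRho A).continuousOn hd (hi1.sub hi2)
  rw [intervalIntegral.integral_sub hi1 hi2] at h
  have e : mean (logRho A) (T, t) - mean (ind (logSet A)) (T, t) =
      (1 / T) * (logRho A t - logRho A (t + T)) := by
    simp only [mean]
    linear_combination (-(1 / T)) * h
  rw [e, abs_mul, abs_of_pos (one_div_pos.2 hT)]
  refine mul_le_of_le_one_right (one_div_pos.2 hT).le (abs_le.2 ⟨?_, ?_⟩) <;>
    linarith [logRho_nonneg A t, logRho_nonneg A (t + T), logRho_le_one A t,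
      logRho_le_one A (t + T)]

theorem mean_add {f g : ℝ → ℝ} (hf : Continuous f) (hg : Continuous g) (p : ℝ × ℝ) :
    mean (fun u => f u + g u) p = mean f p + mean g p := by
  simp only [mean]
  rw [intervalIntegral.integral_add (hf.intervalIntegrable _ _) (hg.intervalIntegrable _ _),
    mul_add]

theorem mean_const_mul (c : ℝ) (f : ℝ → ℝ) (p : ℝ × ℝ) :
    mean (fun u => c * f u) p = c * mean f p := by
  simp only [mean]
  rw [intervalIntegral.integral_const_mul]
  ring

theorem mean_sub {f g : ℝ → ℝ} (hf : Continuous f) (hg : Continuous g) (p : ℝ × ℝ) :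
    mean (fun u => f u - g u) p = mean f p - mean g p := by
  simp only [mean]
  rw [intervalIntegral.integral_sub (hf.intervalIntegrable _ _) (hg.intervalIntegrable _ _),
    mul_sub]

theorem mean_const (c : ℝ) {p : ℝ × ℝ} (hp : 0 < p.1) : mean (fun _ => c) p = c := by
  simp only [mean, intervalIntegral.integral_const, smul_eq_mul]
  field_simp
  ring

theorem mean_mono {f g : ℝ → ℝ} (hf : Continuous f) (hg : Continuous g) {p : ℝ × ℝ}
    (hp : 0 < p.1) (h : ∀ u, f u ≤ g u) : mean f p ≤ mean g p :=
  mul_le_mul_of_nonneg_left (intervalIntegral.integral_mono_on (by linarith)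
    (hf.intervalIntegrable _ _) (hg.intervalIntegrable _ _) fun u _ => h u)
    (one_div_pos.2 hp).le

theorem mean_sum {ι : Type*} (s : Finset ι) (a : ι → ℝ) {f : ι → ℝ → ℝ}
    (hf : ∀ i, Continuous (f i)) (p : ℝ × ℝ) :
    mean (fun u => ∑ i ∈ s, a i * f i u) p = ∑ i ∈ s, a i * mean (f i) p := by
  simp only [mean]
  rw [intervalIntegral.integral_finsetSum (f := fun i u => a i * f i u) fun i _ =>
    (continuous_const.mul (hf i)).intervalIntegrable _ _, Finset.mul_sum]
  refine Finset.sum_congr rfl fun i _ => ?_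
  rw [intervalIntegral.integral_const_mul]
  ring

theorem eventually_windows {P : ℝ → Prop} (h : ∀ᶠ T in atTop, P T) :
    ∀ᶠ p in windows, P p.1 ∧ 0 < p.2 :=
  h.prod_mk (eventually_principal.2 fun _ hx => hx)

theorem tendsto_fst_windows : Tendsto Prod.fst windows atTop := tendsto_fst

theorem eventually_pos_windows : ∀ᶠ p in windows, 0 < p.1 ∧ 0 < p.2 :=
  eventually_windows (eventually_gt_atTop 0)

instance windows_neBot : NeBot windows := by
  have : NeBot (𝓟 (Ioi (0 : ℝ))) := principal_neBot_iff.2 nonempty_Ioi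
  exact prod.instNeBot

theorem tendsto_div_windows (c : ℝ) : Tendsto (fun p : ℝ × ℝ => c / p.1) windows (𝓝 0) :=
  tendsto_fst_windows.const_div_atTop c

/-- Averages over long windows do not see a function that vanishes at infinity. -/
theorem tendsto_mean_zero {f : ℝ → ℝ} (hf : Continuous f) {M : ℝ} (hM : ∀ u, |f u| ≤ M)
    (h0 : Tendsto f atTop (𝓝 0)) : Tendsto (mean f) windows (𝓝 0) := by
  rw [Metric.tendsto_nhds]
  intro ε hε
  obtain ⟨v, hv⟩ := eventually_atTop.1 (Metric.tendsto_nhds.1 h0 (ε / 2) (by linarith))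
  have hM0 : 0 ≤ M := (abs_nonneg _).trans (hM 0)
  set w : ℝ := max v 0 with hw
  have hsmall : ∀ᶠ p in windows, M * w / p.1 < ε / 2 :=
    (tendsto_div_windows (M * w)).eventually_lt_const (by linarith)
  filter_upwards [hsmall, eventually_pos_windows] with p h1 ⟨hT, ht⟩
  obtain ⟨T, t⟩ := p
  simp only at h1 hT ht
  -- The window is cut at `m`; before `m` the bound `M` is used, after `m` the bound `ε / 2`.
  set m : ℝ := min (max w t) (t + T) with hm
  have htm : t ≤ m := le_min (le_max_right _ _) (by linarith)
  have hmT : m ≤ t + T := min_le_right _ _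
  have hmw : m - t ≤ w := by
    have : max w t ≤ w + t := max_le (by linarith) (by linarith [le_max_right v 0])
    linarith [min_le_left (max w t) (t + T)]
  have b1 : ‖∫ u in t..m, f u‖ ≤ M * |m - t| :=
    intervalIntegral.norm_integral_le_of_norm_le_const fun u _ => hM u
  have b2 : ‖∫ u in m..(t + T), f u‖ ≤ ε / 2 * |t + T - m| := by
    refine intervalIntegral.norm_integral_le_of_norm_le_const fun u hu => ?_
    rw [uIoc_of_le hmT] at hu
    have hvu : v ≤ u := by
      have : max w t < u := (min_lt_iff.1 hu.1).resolve_right (not_lt.2 hu.2)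
      exact (le_max_left v 0).trans ((le_max_left w t).trans this.le)
    have := hv u hvu
    rw [Real.dist_eq, sub_zero] at this
    exact this.le
  have hsplit : ∫ u in t..(t + T), f u = (∫ u in t..m, f u) + ∫ u in m..(t + T), f u :=
    (intervalIntegral.integral_add_adjacent_intervals (hf.intervalIntegrable _ _)
      (hf.intervalIntegrable _ _)).symm
  rw [Real.norm_eq_abs] at b1 b2
  rw [abs_of_nonneg (sub_nonneg.2 htm)] at b1
  rw [abs_of_nonneg (sub_nonneg.2 hmT)] at b2
  have b3 : |∫ u in t..(t + T), f u| ≤ M * w + ε / 2 * T := by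
    rw [hsplit]
    refine (abs_add_le _ _).trans (add_le_add (b1.trans ?_) (b2.trans ?_))
    · exact mul_le_mul_of_nonneg_left hmw hM0
    · exact mul_le_mul_of_nonneg_left (by linarith) (by linarith)
  rw [Real.dist_eq, sub_zero, mean, abs_mul, abs_of_pos (one_div_pos.2 hT)]
  calc 1 / T * |∫ u in t..(t + T), f u| ≤ 1 / T * (M * w + ε / 2 * T) :=
        mul_le_mul_of_nonneg_left b3 (one_div_pos.2 hT).le
    _ = M * w / T + ε / 2 := by field_simp
    _ < ε := by linarith

theorem tendsto_mean_shift {f : ℝ → ℝ} (hf : Continuous f) {M : ℝ} (hM : ∀ u, |f u| ≤ M)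
    (c : ℝ) : Tendsto (fun p => mean (fun u => f (u + c)) p - mean f p) windows (𝓝 0) := by
  refine squeeze_zero_norm' ?_ (tendsto_div_windows (2 * M * |c|))
  filter_upwards [eventually_pos_windows] with p ⟨hT, _⟩
  obtain ⟨T, t⟩ := p
  simp only at hT
  have b : ∀ s, |∫ u in s..(s + c), f u| ≤ M * |c| := fun s => by
    have := intervalIntegral.norm_integral_le_of_norm_le_const (a := s) (b := s + c) (f := f)
      fun u _ => hM u
    rwa [add_sub_cancel_left] at this
  have hi : ∀ a b, IntervalIntegrable f volume a b := fun a b => hf.intervalIntegrable a b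
  have e : mean (fun u => f (u + c)) (T, t) - mean f (T, t) =
      1 / T * ((∫ u in (t + T)..(t + T + c), f u) - ∫ u in t..(t + c), f u) := by
    simp only [mean]
    rw [intervalIntegral.integral_comp_add_right,
      ← intervalIntegral.integral_interval_sub_left (hi 0 (t + T + c)) (hi 0 (t + c)),
      ← intervalIntegral.integral_interval_sub_left (hi 0 (t + T)) (hi 0 t),
      ← intervalIntegral.integral_interval_sub_left (hi 0 (t + T + c)) (hi 0 (t + T)),
      ← intervalIntegral.integral_interval_sub_left (hi 0 (t + c)) (hi 0 t)]
    ring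
  rw [e, Real.norm_eq_abs, abs_mul, abs_of_pos (one_div_pos.2 hT)]
  calc 1 / T * |(∫ u in (t + T)..(t + T + c), f u) - ∫ u in t..(t + c), f u|
      ≤ 1 / T * (M * |c| + M * |c|) :=
        mul_le_mul_of_nonneg_left ((abs_sub _ _).trans (add_le_add (b _) (b _)))
          (one_div_pos.2 hT).le
    _ = 2 * M * |c| / T := by ring

theorem tendsto_logRho {C : Set ℝ} (hC : MeasurableSet C) {l : ℝ}
    (h : Tendsto (rho C) atTop (𝓝 l)) : Tendsto (logRho C) atTop (𝓝 l) :=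
  (h.comp Real.tendsto_exp_atTop).congr fun u => rho_eq hC (Real.exp_pos u).le

theorem density_mem_Icc {C : Set ℝ} (hC : MeasurableSet C) {l : ℝ}
    (h : Tendsto (rho C) atTop (𝓝 l)) : l ∈ Icc (0 : ℝ) 1 :=
  isClosed_Icc.mem_of_tendsto (tendsto_logRho hC h)
    (Eventually.of_forall fun u => ⟨logRho_nonneg C u, logRho_le_one C u⟩)

theorem tendsto_mean_logRho_of_density {C : Set ℝ} (hC : MeasurableSet C) {l : ℝ}
    (h : Tendsto (rho C) atTop (𝓝 l)) : Tendsto (mean (logRho C)) windows (𝓝 l) := by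
  have hl := density_mem_Icc hC h
  have h0 : Tendsto (mean fun u => logRho C u - l) windows (𝓝 0) := by
    refine tendsto_mean_zero ((continuous_logRho C).sub continuous_const) (M := 1) (fun u => ?_) ?_
    · refine abs_le.2 ⟨?_, ?_⟩ <;> linarith [logRho_nonneg C u, logRho_le_one C u, hl.1, hl.2]
    · simpa using (tendsto_logRho hC h).sub_const l
  have h1 : Tendsto (fun p => mean (fun u => logRho C u - l) p + l) windows (𝓝 l) := by
    simpa using h0.add_const l
  refine h1.congr' ?_
  filter_upwards [eventually_pos_windows] with p hp
  rw [mean_sub (continuous_logRho C) continuous_const, mean_const l hp.1]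
  ring

/-- Thinning by a set of density `l` multiplies logarithmic averages over long windows by `l`. For
`l > 0`, thinning is asymptotically a dilation by `1 / l`, which becomes a translation on the
logarithmic scale. -/
theorem tendsto_mean_logRho_thin {C A : Set ℝ} (hC : MeasurableSet C) (hA : MeasurableSet A)
    {l : ℝ} (h : Tendsto (rho C) atTop (𝓝 l)) :
    Tendsto (fun p => mean (logRho (thin C A)) p - l * mean (logRho A) p) windows (𝓝 0) := by
  have hl := density_mem_Icc hC h
  rcases hl.1.eq_or_lt with rfl | hpos
  · have hle : ∀ u, logRho (thin C A) u ≤ logRho C u := fun u => by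
      rw [logRho, cumul_thin C hA]
      exact div_le_div_of_nonneg_right (cumul_le_self A (cumul_nonneg C _)) (Real.exp_pos u).le
    have := tendsto_mean_zero (continuous_logRho (thin C A)) (abs_logRho_le_one _)
      (squeeze_zero (logRho_nonneg _) hle (tendsto_logRho hC h))
    simpa using this
  have hsc : Continuous fun u => l * logRho A (u + Real.log l) :=
    continuous_const.mul ((continuous_logRho A).comp (continuous_id.add continuous_const))
  have h1 : Tendsto (mean fun u => logRho (thin C A) u - l * logRho A (u + Real.log l)) windows
      (𝓝 0) := by
    refine tendsto_mean_zero ((continuous_logRho _).sub hsc) (M := 1) (fun u => ?_) ?_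
    · have a1 := mul_nonneg hpos.le (logRho_nonneg A (u + Real.log l))
      have a2 := mul_le_one₀ hl.2 (logRho_nonneg A (u + Real.log l)) (logRho_le_one A _)
      refine abs_le.2 ⟨?_, ?_⟩ <;>
        linarith [logRho_nonneg (thin C A) u, logRho_le_one (thin C A) u]
    · have h2 : Tendsto (fun u => |logRho C u - l|) atTop (𝓝 0) := by
        simpa using ((tendsto_logRho hC h).sub_const l).abs
      refine squeeze_zero_norm (fun u => ?_) h2
      have he := Real.exp_pos u
      have e1 : logRho (thin C A) u - l * logRho A (u + Real.log l) =
          (cumul A (cumul C (Real.exp u)) - cumul A (Real.exp u * l)) / Real.exp u := by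
        rw [logRho, logRho, cumul_thin C hA, Real.exp_add, Real.exp_log hpos]
        field_simp
      have e2 : logRho C u - l = (cumul C (Real.exp u) - Real.exp u * l) / Real.exp u := by
        rw [logRho]
        field_simp
      rw [e1, e2, Real.norm_eq_abs, abs_div, abs_div]
      exact div_le_div_of_nonneg_right (abs_cumul_sub_le A _ _) (abs_nonneg _)
  have h3 := h1.add ((tendsto_mean_shift (continuous_logRho A) (abs_logRho_le_one A)
    (Real.log l)).const_mul l)
  rw [mul_zero, add_zero] at h3
  refine h3.congr fun p => ?_
  rw [mean_sub (continuous_logRho _) hsc, mean_const_mul]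
  ring

/-! ### Limits of logarithmic averages are coherent weakly thinnable pairs -/

theorem cumul_Ici {c x : ℝ} (hc : 0 ≤ c) (hx : c ≤ x) : cumul (Ici c) x = x - c := by
  have : Ici c ∩ Ico 0 x = Ico c x := by
    ext y
    exact ⟨fun h => ⟨h.1, h.2.2⟩, fun h => ⟨h.1, hc.trans h.1, h.2⟩⟩
  rw [cumul, this, Real.volume_Ico, ENNReal.toReal_ofReal (by linarith)]

theorem tendsto_rho_Ici {c : ℝ} (hc : 0 ≤ c) : Tendsto (rho (Ici c)) atTop (𝓝 1) := by
  have h : Tendsto (fun x : ℝ => 1 - c / x) atTop (𝓝 1) := by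
    simpa using (tendsto_id.const_div_atTop c).const_sub (1 : ℝ)
  refine h.congr' ?_
  filter_upwards [eventually_ge_atTop c, eventually_gt_atTop 0] with x h1 h2
  rw [rho_eq measurableSet_Ici h2.le, cumul_Ici hc h1, sub_div, div_self h2.ne']

theorem Ici_mem_densitySets {c : ℝ} (hc : 0 ≤ c) : Ici c ∈ densitySets :=
  ⟨mem_intervalSets_iff.2 (isStepSet_Ici hc), 1, tendsto_rho_Ici hc⟩

/-- If a bet is bounded above by `s`, so is its average over `[0, e^u]`. -/
theorem sum_mul_logRho_sub_le {n : ℕ} {a m : Fin n → ℝ} {A : Fin n → Set ℝ}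
    (hA : ∀ i, IsStepSet (A i)) {s : ℝ}
    (hs : ∀ x ∈ halfLine, ∑ i, a i * (ind (A i) x - m i) ≤ s) (u : ℝ) :
    ∑ i, a i * (logRho (A i) u - m i) ≤ s := by
  have he := Real.exp_pos u
  have hi : ∀ i, IntervalIntegrable (fun x => a i * (ind (A i) x - m i)) volume 0 (Real.exp u) :=
    fun i => ((intervalIntegrable_ind (hA i).measurableSet _ _).sub
      intervalIntegrable_const).const_mul _
  have h1 : ∫ x in (0 : ℝ)..Real.exp u, ∑ i, a i * (ind (A i) x - m i) ≤
      ∫ x in (0 : ℝ)..Real.exp u, s := by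
    refine intervalIntegral.integral_mono_on he.le ?_ intervalIntegrable_const
      fun x hx => hs x hx.1
    have := IntervalIntegrable.sum Finset.univ (f := fun i x => a i * (ind (A i) x - m i))
      fun i _ => hi i
    simpa [Finset.sum_fn] using this
  rw [intervalIntegral.integral_finsetSum (f := fun i x => a i * (ind (A i) x - m i))
    fun i _ => hi i, intervalIntegral.integral_const, sub_zero, smul_eq_mul] at h1
  have h2 : ∀ i, ∫ x in (0 : ℝ)..Real.exp u, a i * (ind (A i) x - m i) =
      Real.exp u * (a i * (logRho (A i) u - m i)) := fun i => by
    rw [intervalIntegral.integral_const_mul, intervalIntegral.integral_sub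
      (intervalIntegrable_ind (hA i).measurableSet _ _) intervalIntegrable_const,
      ← cumul_eq_integral (hA i).measurableSet he.le, intervalIntegral.integral_const, logRho]
    simp only [sub_zero, smul_eq_mul]
    field_simp
  simp only [h2] at h1
  rw [← Finset.mul_sum] at h1
  exact le_of_mul_le_mul_left h1 he

theorem mean_logRho_mem_Icc (A : Set ℝ) {p : ℝ × ℝ} (hp : 0 < p.1) :
    mean (logRho A) p ∈ Icc (0 : ℝ) 1 := by
  rw [← mean_const 0 hp, ← mean_const 1 hp]
  exact ⟨mean_mono continuous_const (continuous_logRho A) hp (logRho_nonneg A),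
    mean_mono (continuous_logRho A) continuous_const hp (logRho_le_one A)⟩

/-- Along any filter of windows whose length tends to infinity, the sets of `𝓜` whose
logarithmic averages converge form, with the limit as measure, a coherent weakly thinnable pair.
The filter `windows` itself yields `(𝓐ᵘⁿⁱ, α)`, and finer ultrafilters yield pairs on all
of `𝓜`. -/
theorem mem_WTC_of_tendsto_mean {G : Filter (ℝ × ℝ)} [NeBot G] (hG : G ≤ windows)
    {F : Set (Set ℝ)} {μ : Set ℝ → ℝ}
    (hF : ∀ A l, A ∈ intervalSets → Tendsto (mean (logRho A)) G (𝓝 l) → A ∈ F)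
    (hM : F ⊆ intervalSets) (hμ : ∀ A ∈ F, Tendsto (mean (logRho A)) G (𝓝 (μ A))) :
    (F, μ) ∈ WTC := by
  have step : ∀ A ∈ F, IsStepSet A := fun A hA => mem_intervalSets_iff.1 (hM hA)
  have pos : ∀ᶠ p in G, 0 < p.1 ∧ 0 < p.2 := hG eventually_pos_windows
  have val : ∀ A l, IsStepSet A → Tendsto (mean (logRho A)) G (𝓝 l) → A ∈ F ∧ μ A = l :=
    fun A l hA h => by
      have hAF := hF A l (mem_intervalSets_iff.2 hA) h
      exact ⟨hAF, tendsto_nhds_unique (hμ A hAF) h⟩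
  have dens : ∀ C ∈ densitySets, ∀ l, Tendsto (rho C) atTop (𝓝 l) → C ∈ F ∧ μ C = l :=
    fun C hC l hl => by
      have hs := mem_intervalSets_iff.1 hC.1
      exact val C l hs ((tendsto_mean_logRho_of_density hs.measurableSet hl).mono_left hG)
  have compl : ∀ A ∈ F, halfLine \ A ∈ F := fun A hA => by
    refine (val _ (1 - μ A) (step A hA).compl (((hμ A hA).const_sub 1).congr' ?_)).1
    filter_upwards [pos] with p hp
    rw [show logRho (halfLine \ A) = fun u => 1 - logRho A u from
      funext (logRho_compl (step A hA)), mean_sub continuous_const (continuous_logRho A),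
      mean_const 1 hp.1]
  have union : ∀ A ∈ F, ∀ B ∈ F, A ∩ B = ∅ → A ∪ B ∈ F ∧ μ (A ∪ B) = μ A + μ B :=
    fun A hA B hB h => by
      refine val _ _ ((step A hA).union (step B hB)) (((hμ A hA).add (hμ B hB)).congr fun p => ?_)
      rw [show logRho (A ∪ B) = fun u => logRho A u + logRho B u from
        funext (logRho_union (step B hB).measurableSet h),
        mean_add (continuous_logRho A) (continuous_logRho B)]
  have thin' : ∀ C ∈ densitySets, ∀ A ∈ F, thin C A ∈ F ∧ μ (thin C A) = μ C * μ A :=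
    fun C hC A hA => by
      obtain ⟨l, hl⟩ := hC.2
      have hs := mem_intervalSets_iff.1 hC.1
      rw [(dens C hC l hl).2]
      have h := ((tendsto_mean_logRho_thin hs.measurableSet (step A hA).measurableSet
        hl).mono_left hG).add ((hμ A hA).const_mul l)
      rw [zero_add] at h
      exact val _ _ (hs.thin (step A hA)) (h.congr fun p => by ring)
  have tail : ∀ c ∈ halfLine, Ici c ∈ F ∧ μ (Ici c) = 1 := fun c hc =>
    dens _ (Ici_mem_densitySets hc) 1 (tendsto_rho_Ici hc)
  refine ⟨⟨⟨⟨⟨_, (tail 0 self_mem_Ici).1⟩, fun A hA => (step A hA).nonneg,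
    fun A hA B hB h => (union A hA B hB h).1, compl⟩, fun A hA => ?_,
    fun A hA B hB h => (union A hA B hB h).2, (tail 0 self_mem_Ici).2⟩, hM,
    fun C hC A hA => (thin' C hC A hA).1, fun C hC A hA => (thin' C hC A hA).2,
    fun A hA B hB h => ?_, fun c hc => (tail c hc).2⟩, fun n a A hA => ?_⟩
  · refine isClosed_Icc.mem_of_tendsto (hμ A hA) ?_
    filter_upwards [pos] with p hp using mean_logRho_mem_Icc A hp.1
  · refine le_of_tendsto_of_tendsto (hμ B hB) (hμ A hA) ?_
    filter_upwards [pos] with p hp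
    exact mean_mono (continuous_logRho B) (continuous_logRho A) hp.1 fun u =>
      div_le_div_of_nonneg_right (h _ (Real.exp_pos u).le) (Real.exp_pos u).le
  · have hb : BddAbove (range fun x : halfLine => ∑ i, a i * (ind (A i) (x : ℝ) - μ (A i))) := by
      refine ⟨∑ i, |a i| * (1 + |μ (A i)|), ?_⟩
      rintro _ ⟨x, rfl⟩
      refine Finset.sum_le_sum fun i _ => (le_abs_self _).trans ?_
      rw [abs_mul]
      refine mul_le_mul_of_nonneg_left ((abs_sub _ _).trans (add_le_add ?_ le_rfl)) (abs_nonneg _)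
      rw [abs_of_nonneg (ind_nonneg _ _)]
      exact ind_le_one _ _
    have hs : ∀ x ∈ halfLine, ∑ i, a i * (ind (A i) x - μ (A i)) ≤
        ⨆ x : halfLine, ∑ i, a i * (ind (A i) (x : ℝ) - μ (A i)) :=
      fun x hx => le_ciSup hb ⟨x, hx⟩
    have hu := sum_mul_logRho_sub_le (fun i => step _ (hA i)) hs
    have hlim : Tendsto (fun p => ∑ i, a i * (mean (logRho (A i)) p - μ (A i))) G (𝓝 0) := by
      have : Tendsto (fun p => ∑ i, a i * (mean (logRho (A i)) p - μ (A i))) G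
          (𝓝 (∑ i, a i * (μ (A i) - μ (A i)))) :=
        tendsto_finsetSum _ fun i _ => ((hμ _ (hA i)).sub_const _).const_mul _
      simpa using this
    refine le_of_tendsto hlim ?_
    filter_upwards [pos] with p hp
    have hc : ∀ i, Continuous fun u => logRho (A i) u - μ (A i) := fun i =>
      (continuous_logRho _).sub continuous_const
    have h := mean_mono (f := fun u => ∑ i, a i * (logRho (A i) u - μ (A i)))
      (continuous_finsetSum _ fun i _ => continuous_const.mul (hc i)) continuous_const hp.1 hu
    rw [mean_const _ hp.1, mean_sum _ _ hc] at h
    refine le_trans (le_of_eq (Finset.sum_congr rfl fun i _ => ?_)) h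
    rw [mean_sub (continuous_logRho _) continuous_const, mean_const _ hp.1]

/-- Along an ultrafilter of windows every set of `𝓜` has a limiting logarithmic average, so the
limits form a coherent weakly thinnable pair on `𝓜`. -/
theorem exists_mem_WTC_of_ultrafilter (G : Ultrafilter (ℝ × ℝ)) (hG : ↑G ≤ windows) :
    ∃ μ : Set ℝ → ℝ, (∀ A, Tendsto (mean (logRho A)) G (𝓝 (μ A))) ∧ (intervalSets, μ) ∈ WTC := by
  have hex : ∀ A : Set ℝ, ∃ l, Tendsto (mean (logRho A)) G (𝓝 l) := fun A => by
    have hev : ∀ᶠ p in (G : Filter (ℝ × ℝ)), mean (logRho A) p ∈ Icc (0 : ℝ) 1 := by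
      filter_upwards [hG eventually_pos_windows] with p hp using mean_logRho_mem_Icc A hp.1
    obtain ⟨l, -, hl⟩ := isCompact_Icc.ultrafilter_le_nhds (G.map (mean (logRho A)))
      (le_principal_iff.2 hev)
    exact ⟨l, hl⟩
  choose μ hμ using hex
  exact ⟨μ, hμ, mem_WTC_of_tendsto_mean hG (fun A _ h _ => h) Subset.rfl fun A _ => hμ A⟩

/-! ### The pair `(𝓐ᵘⁿⁱ, α)` as a uniform limit of logarithmic averages -/

theorem sigma_mem_Icc {W : Set ℝ} (hW : MeasurableSet W) {D : ℝ} (hD : 0 < D) (x : ℝ) :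
    sigma W D x ∈ Icc (0 : ℝ) 1 := by
  have h0 : 0 ≤ ∫ y in x..(x + D), ind W y :=
    intervalIntegral.integral_nonneg (by linarith) fun u _ => ind_nonneg W u
  have h1 : ∫ y in x..(x + D), ind W y ≤ ∫ y in x..(x + D), (1 : ℝ) :=
    intervalIntegral.integral_mono_on (by linarith) (intervalIntegrable_ind hW _ _)
      intervalIntegrable_const fun u _ => ind_le_one W u
  rw [intervalIntegral.integral_const, smul_eq_mul, mul_one, add_sub_cancel_left] at h1
  refine ⟨mul_nonneg (one_div_pos.2 hD).le h0, ?_⟩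
  rw [sigma, one_div, inv_mul_le_iff₀ hD]
  linarith

theorem bddAbove_sigma {W : Set ℝ} (hW : MeasurableSet W) {D : ℝ} (hD : 0 < D) :
    BddAbove (range fun x : Ioi (0 : ℝ) => sigma W D x) :=
  ⟨1, by rintro _ ⟨x, rfl⟩; exact (sigma_mem_Icc hW hD x).2⟩

theorem bddBelow_sigma {W : Set ℝ} (hW : MeasurableSet W) {D : ℝ} (hD : 0 < D) :
    BddBelow (range fun x : Ioi (0 : ℝ) => sigma W D x) :=
  ⟨0, by rintro _ ⟨x, rfl⟩; exact (sigma_mem_Icc hW hD x).1⟩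

instance : Nonempty (Ioi (0 : ℝ)) := ⟨⟨1, mem_Ioi.2 one_pos⟩⟩

theorem eventually_sigma_lt {W : Set ℝ} (hW : MeasurableSet W) {ε : ℝ} (hε : 0 < ε) :
    ∀ᶠ D in atTop, ∀ x > 0, sigma W D x < upperU W + ε := by
  have hb : IsBoundedUnder (· ≤ ·) atTop fun D : ℝ => ⨆ x : Ioi (0 : ℝ), sigma W D x := by
    refine ⟨1, eventually_map.2 ?_⟩
    filter_upwards [eventually_gt_atTop 0] with D hD
    exact ciSup_le fun x => (sigma_mem_Icc hW hD x).2
  filter_upwards [eventually_lt_of_limsup_lt (show upperU W < upperU W + ε by linarith) hb,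
    eventually_gt_atTop 0] with D h1 hD x hx
  exact (le_ciSup (bddAbove_sigma hW hD) ⟨x, hx⟩).trans_lt h1

theorem eventually_lt_sigma {W : Set ℝ} (hW : MeasurableSet W) {ε : ℝ} (hε : 0 < ε) :
    ∀ᶠ D in atTop, ∀ x > 0, lowerL W - ε < sigma W D x := by
  have hb : IsBoundedUnder (· ≥ ·) atTop fun D : ℝ => ⨅ x : Ioi (0 : ℝ), sigma W D x := by
    refine ⟨0, eventually_map.2 ?_⟩
    filter_upwards [eventually_gt_atTop 0] with D hD
    exact le_ciInf fun x => (sigma_mem_Icc hW hD x).1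
  filter_upwards [eventually_lt_of_lt_liminf (show lowerL W - ε < lowerL W by linarith) hb,
    eventually_gt_atTop 0] with D h1 hD x hx
  exact h1.trans_le (ciInf_le (bddBelow_sigma hW hD) ⟨x, hx⟩)

theorem tendsto_mean_logRho_sub {A : Set ℝ} (hA : IsStepSet A) :
    Tendsto (fun p => mean (logRho A) p - mean (ind (logSet A)) p) windows (𝓝 0) := by
  refine squeeze_zero_norm' ?_ (tendsto_div_windows 1)
  filter_upwards [eventually_pos_windows] with p hp
  exact abs_mean_logRho_sub_le hA hp.1 hp.2.le

theorem tendsto_mean_ind_iff {A : Set ℝ} (hA : IsStepSet A) {l : ℝ} :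
    Tendsto (mean (ind (logSet A))) windows (𝓝 l) ↔
      Tendsto (mean (logRho A)) windows (𝓝 l) := by
  refine ⟨fun h => ?_, fun h => ?_⟩
  · simpa using (tendsto_mean_logRho_sub hA).add h
  · simpa using h.sub (tendsto_mean_logRho_sub hA)

theorem tendsto_mean_ind_of_eq {W : Set ℝ} (hW : MeasurableSet W) (h : lowerL W = upperU W) :
    Tendsto (mean (ind W)) windows (𝓝 (upperU W)) := by
  rw [Metric.tendsto_nhds]
  intro ε hε
  filter_upwards [eventually_windows (eventually_sigma_lt hW hε),
    eventually_windows (eventually_lt_sigma hW hε)] with p h1 h2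
  have h3 := h1.1 p.2 h1.2
  have h4 := h2.1 p.2 h2.2
  rw [Real.dist_eq, abs_lt]
  exact ⟨by change _ < sigma W p.1 p.2 - _; linarith, by change sigma W p.1 p.2 - _ < _; linarith⟩

theorem eventually_abs_sigma_sub_le {W : Set ℝ} {l : ℝ}
    (h : Tendsto (mean (ind W)) windows (𝓝 l)) {ε : ℝ} (hε : 0 < ε) :
    ∀ᶠ D in atTop, ∀ x > 0, |sigma W D x - l| < ε := by
  have := Metric.tendsto_nhds.1 h ε hε
  rw [windows, eventually_prod_principal_iff] at this
  exact this

theorem bounds_of_tendsto_mean_ind {W : Set ℝ} (hW : MeasurableSet W) {l : ℝ}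
    (h : Tendsto (mean (ind W)) windows (𝓝 l)) : lowerL W = l ∧ upperU W = l := by
  constructor
  · refine Tendsto.liminf_eq (Metric.tendsto_nhds.2 fun ε hε => ?_)
    filter_upwards [eventually_abs_sigma_sub_le h (half_pos hε), eventually_gt_atTop 0]
      with D h1 hD
    rw [Real.dist_eq, abs_lt]
    have h2 : l - ε / 2 ≤ ⨅ x : Ioi (0 : ℝ), sigma W D x :=
      le_ciInf fun x => by linarith [(abs_lt.1 (h1 x x.2)).1]
    have h3 := ciInf_le (bddBelow_sigma hW hD) ⟨1, mem_Ioi.2 one_pos⟩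
    have h4 := (abs_lt.1 (h1 1 one_pos)).2
    exact ⟨by linarith, by linarith⟩
  · refine Tendsto.limsup_eq (Metric.tendsto_nhds.2 fun ε hε => ?_)
    filter_upwards [eventually_abs_sigma_sub_le h (half_pos hε), eventually_gt_atTop 0]
      with D h1 hD
    rw [Real.dist_eq, abs_lt]
    have h2 : ⨆ x : Ioi (0 : ℝ), sigma W D x ≤ l + ε / 2 :=
      ciSup_le fun x => by linarith [(abs_lt.1 (h1 x x.2)).2]
    have h3 := le_ciSup (bddAbove_sigma hW hD) ⟨1, mem_Ioi.2 one_pos⟩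
    have h4 := (abs_lt.1 (h1 1 one_pos)).1
    exact ⟨by linarith, by linarith⟩

/-- The windows defining `U` and `L` start at `x > 0`; letting `x → 0` gives the windows `[0, D]`
of the natural density. -/
theorem tendsto_rho_of_tendsto_mean_ind {W : Set ℝ} (hW : MeasurableSet W) {l : ℝ}
    (h : Tendsto (mean (ind W)) windows (𝓝 l)) : Tendsto (rho W) atTop (𝓝 l) := by
  refine Metric.tendsto_nhds.2 fun ε hε => ?_
  filter_upwards [eventually_abs_sigma_sub_le h (half_pos hε), eventually_gt_atTop 0] with D h1 hD
  have hc : Tendsto (fun x => (1 / D) * (cumul W (x + D) - cumul W x)) (𝓝[>] 0)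
      (𝓝 (rho W D)) := by
    have : Continuous fun x => (1 / D) * (cumul W (x + D) - cumul W x) :=
      continuous_const.mul (((continuous_cumul W).comp
        (continuous_id.add continuous_const)).sub (continuous_cumul W))
    have h0 := this.tendsto 0
    rw [zero_add, cumul_of_nonpos W le_rfl, sub_zero, one_div_mul_eq_div,
      ← rho_eq hW hD.le] at h0
    exact h0.mono_left nhdsWithin_le_nhds
  have hle : |rho W D - l| ≤ ε / 2 := by
    refine le_of_tendsto (hc.sub_const l).abs ?_
    filter_upwards [self_mem_nhdsWithin] with x hx
    have hx : 0 < x := hx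
    rw [cumul_sub hW hx.le (by linarith)]
    exact (h1 x hx).le
  rw [Real.dist_eq]
  linarith

theorem Auni_spec {A : Set ℝ} (hA : A ∈ Auni) :
    logSet A ∈ densitySets ∧ lowerL (logSet A) = alpha A ∧ upperU (logSet A) = alpha A ∧
      Tendsto (mean (logRho A)) windows (𝓝 (alpha A)) := by
  have hs := mem_intervalSets_iff.1 hA.1
  have h := tendsto_mean_ind_of_eq hs.logSet.measurableSet hA.2.2
  have hr := tendsto_rho_of_tendsto_mean_ind hs.logSet.measurableSet h
  have ha : alpha A = upperU (logSet A) := hr.limUnder_eq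
  rw [ha]
  exact ⟨⟨hA.2.1, _, hr⟩, hA.2.2, rfl, (tendsto_mean_ind_iff hs).1 h⟩

theorem mem_Auni_of_tendsto {A : Set ℝ} (hA : A ∈ intervalSets) {l : ℝ}
    (h : Tendsto (mean (logRho A)) windows (𝓝 l)) : A ∈ Auni := by
  have hs := mem_intervalSets_iff.1 hA
  obtain ⟨h1, h2⟩ := bounds_of_tendsto_mean_ind hs.logSet.measurableSet
    ((tendsto_mean_ind_iff hs).2 h)
  exact ⟨hA, mem_intervalSets_iff.2 hs.logSet, h1.trans h2.symm⟩

theorem Auni_mem_WTC : (Auni, alpha) ∈ WTC :=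
  mem_WTC_of_tendsto_mean le_rfl (fun _ _ hA h => mem_Auni_of_tendsto hA h) (fun _ hA => hA.1)
    fun _ hA => (Auni_spec hA).2.2.2

/-! ### Combs: periodic sets of prescribed density -/

/-- The set of all `x ≥ 0` with fractional part in `[a, b)`, for `0 ≤ a ≤ b ≤ 1`. -/
def comb (a b : ℝ) : Set ℝ := ⋃ k : ℕ, Ico (k + a) (k + b)

theorem mem_comb_iff {a b y : ℝ} (ha : 0 ≤ a) (hb : b ≤ 1) {n : ℕ} (hy : y ∈ Ico (n : ℝ) (n + 1)) :
    y ∈ comb a b ↔ y ∈ Ico (n + a) (n + b) := by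
  refine ⟨fun h => ?_, fun h => mem_iUnion.2 ⟨n, h⟩⟩
  obtain ⟨k, hk⟩ := mem_iUnion.1 h
  have h1 : (k : ℝ) < n + 1 := by linarith [hk.1, hy.2]
  have h2 : (n : ℝ) < k + 1 := by linarith [hk.2, hy.1]
  norm_cast at h1 h2
  obtain rfl : k = n := by omega
  exact hk

theorem comb_nonneg {a b y : ℝ} (ha : 0 ≤ a) (hy : y ∈ comb a b) : 0 ≤ y := by
  obtain ⟨k, hk⟩ := mem_iUnion.1 hy
  exact (add_nonneg k.cast_nonneg ha).trans hk.1

theorem comb_disjoint {a b c d : ℝ} (ha : 0 ≤ a) (hbc : b ≤ c) (hc : 0 ≤ c) (hb : b ≤ 1)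
    (hd : d ≤ 1) : Disjoint (comb a b) (comb c d) := by
  refine Set.disjoint_left.2 fun y h1 h2 => ?_
  have hy : y ∈ Ico (⌊y⌋₊ : ℝ) (⌊y⌋₊ + 1) :=
    ⟨Nat.floor_le (comb_nonneg ha h1), Nat.lt_floor_add_one y⟩
  have h1 := (mem_comb_iff ha hb hy).1 h1
  have h2 := (mem_comb_iff hc hd hy).1 h2
  linarith [h1.2, h2.1]

theorem comb_mem_intervalSets {a b : ℝ} (ha : 0 ≤ a) (hab : a ≤ b) (hb : b ≤ 1) :
    comb a b ∈ intervalSets := by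
  have e0 : ∀ k : ℕ, (2 * k) / 2 = k := fun k => by omega
  have e1 : ∀ k : ℕ, (2 * k + 1) / 2 = k := fun k => by omega
  refine ⟨fun i => ((i / 2 : ℕ) : ℝ) + if Even i then a else b, by simpa, ?_, ?_, ?_⟩
  · refine monotone_nat_of_le_succ fun i => ?_
    rcases Nat.even_or_odd' i with ⟨k, rfl | rfl⟩
    · have h1 : ¬ Even (2 * k + 1) := by simp
      simp only [e0, e1, even_two_mul, if_true, if_neg h1]
      linarith
    · have h1 : ¬ Even (2 * k + 1) := by simp
      have h2 : 2 * k + 1 + 1 = 2 * (k + 1) := by ring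
      rw [h2]
      simp only [e0, e1, even_two_mul, if_true, if_neg h1]
      push_cast
      linarith
  · refine tendsto_atTop_mono (fun i => ?_) (tendsto_natCast_atTop_atTop.comp
      (Nat.tendsto_div_const_atTop (two_ne_zero)))
    have : 0 ≤ if Even i then a else b := by split_ifs <;> linarith
    simpa using this
  · refine iUnion_congr fun k => ?_
    have h1 : ¬ Even (2 * k + 1) := by simp
    simp only [e0, e1, even_two_mul, if_true, if_neg h1]

theorem cumul_comb_natCast {a b : ℝ} (ha : 0 ≤ a) (hab : a ≤ b) (hb : b ≤ 1) (n : ℕ) :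
    cumul (comb a b) n = n * (b - a) := by
  induction n with
  | zero => simp [cumul_of_nonpos]
  | succ n ih =>
    have hn : (0 : ℝ) ≤ n := n.cast_nonneg
    have h : comb a b ∩ Ico 0 ((n + 1 : ℕ) : ℝ) =
        comb a b ∩ Ico 0 (n : ℝ) ∪ Ico (n + a) (n + b) := by
      push_cast
      ext y
      constructor
      · rintro ⟨h1, h2⟩
        rcases lt_or_ge y n with h3 | h3
        · exact Or.inl ⟨h1, h2.1, h3⟩
        · exact Or.inr ((mem_comb_iff ha hb ⟨h3, h2.2⟩).1 h1)
      · rintro (⟨h1, h2⟩ | h1)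
        · exact ⟨h1, h2.1, by linarith [h2.2]⟩
        · exact ⟨mem_iUnion.2 ⟨n, h1⟩, by linarith [h1.1], by linarith [h1.2]⟩
    have hd : Disjoint (comb a b ∩ Ico 0 (n : ℝ)) (Ico (n + a) (n + b)) :=
      Set.disjoint_left.2 fun y h1 h2 => by linarith [h1.2.2, h2.1]
    have ih' : (volume (comb a b ∩ Ico 0 (n : ℝ))).toReal = n * (b - a) := ih
    rw [cumul, h, measure_union hd measurableSet_Ico,
      ENNReal.toReal_add (volume_inter_Ico_ne_top _ _ _) (by simp), ih', Real.volume_Ico,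
      ENNReal.toReal_ofReal (by linarith)]
    push_cast
    ring

theorem abs_cumul_comb_sub_le {a b : ℝ} (ha : 0 ≤ a) (hab : a ≤ b) (hb : b ≤ 1) {x : ℝ}
    (hx : 0 ≤ x) : |cumul (comb a b) x - (b - a) * x| ≤ 1 := by
  have h1 := cumul_mono (comb a b) (Nat.floor_le hx)
  have h2 := cumul_mono (comb a b) (Nat.lt_floor_add_one x).le
  have h3 := cumul_comb_natCast ha hab hb (⌊x⌋₊ + 1)
  rw [cumul_comb_natCast ha hab hb] at h1
  push_cast at h3
  rw [h3] at h2
  have h4 := mul_le_mul_of_nonneg_left (Nat.floor_le hx) (sub_nonneg.2 hab)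
  have h5 := mul_le_mul_of_nonneg_left (Nat.lt_floor_add_one x).le (sub_nonneg.2 hab)
  refine abs_le.2 ⟨?_, ?_⟩ <;> nlinarith

theorem tendsto_rho_comb {a b : ℝ} (ha : 0 ≤ a) (hab : a ≤ b) (hb : b ≤ 1) :
    Tendsto (rho (comb a b)) atTop (𝓝 (b - a)) := by
  have hm := (mem_intervalSets_iff.1 (comb_mem_intervalSets ha hab hb)).measurableSet
  have h0 : Tendsto (fun x => rho (comb a b) x - (b - a)) atTop (𝓝 0) := by
    refine squeeze_zero_norm' ?_ (tendsto_id.const_div_atTop (1 : ℝ))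
    filter_upwards [eventually_gt_atTop 0] with x hx
    have e : rho (comb a b) x - (b - a) = (cumul (comb a b) x - (b - a) * x) / x := by
      rw [rho_eq hm hx.le]
      field_simp
    rw [e, Real.norm_eq_abs, abs_div, abs_of_pos hx]
    exact div_le_div_of_nonneg_right (abs_cumul_comb_sub_le ha hab hb hx.le) hx.le
  simpa using h0.add_const (b - a)

theorem comb_mem_densitySets {a b : ℝ} (ha : 0 ≤ a) (hab : a ≤ b) (hb : b ≤ 1) :
    comb a b ∈ densitySets :=
  ⟨comb_mem_intervalSets ha hab hb, _, tendsto_rho_comb ha hab hb⟩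

/-! ### Finite disjoint unions -/

theorem isStepSet_biUnion {ι : Type*} {s : Finset ι} {D : ι → Set ℝ}
    (hD : ∀ i ∈ s, IsStepSet (D i)) : IsStepSet (⋃ i ∈ s, D i) := by
  classical
  induction s using Finset.induction_on with
  | empty =>
    have h := isStepSet_halfLine.compl
    rw [Set.sdiff_self] at h
    simpa using h
  | insert i s hi ih =>
    rw [Finset.set_biUnion_insert]
    exact (hD i (Finset.mem_insert_self _ _)).union
      (ih fun j hj => hD j (Finset.mem_insert_of_mem hj))

theorem inter_biUnion_eq_empty {ι : Type*} {s : Finset ι} {D : ι → Set ℝ} {i : ι}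
    (h : ∀ j ∈ s, Disjoint (D i) (D j)) : D i ∩ ⋃ j ∈ s, D j = ∅ :=
  disjoint_iff_inter_eq_empty.1 (disjoint_iUnion₂_right.2 h)

theorem cumul_biUnion {ι : Type*} {s : Finset ι} {D : ι → Set ℝ}
    (hD : ∀ i ∈ s, IsStepSet (D i)) (hd : (s : Set ι).PairwiseDisjoint D) (x : ℝ) :
    cumul (⋃ i ∈ s, D i) x = ∑ i ∈ s, cumul (D i) x := by
  classical
  induction s using Finset.induction_on with
  | empty => simp [cumul]
  | insert i s hi ih =>
    have hs : ∀ j ∈ s, IsStepSet (D j) := fun j hj => hD j (Finset.mem_insert_of_mem hj)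
    rw [Finset.set_biUnion_insert, Finset.sum_insert hi, cumul_union
      (isStepSet_biUnion hs).measurableSet, ih hs (hd.subset (by simp))]
    exact inter_biUnion_eq_empty fun j hj => hd (by simp) (by simp [hj])
      fun h => hi (h ▸ hj)

theorem tendsto_rho_biUnion {ι : Type*} {s : Finset ι} {D : ι → Set ℝ} {l : ι → ℝ}
    (hD : ∀ i ∈ s, IsStepSet (D i)) (hd : (s : Set ι).PairwiseDisjoint D)
    (hl : ∀ i ∈ s, Tendsto (rho (D i)) atTop (𝓝 (l i))) :
    Tendsto (rho (⋃ i ∈ s, D i)) atTop (𝓝 (∑ i ∈ s, l i)) := by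
  refine (tendsto_finsetSum s hl).congr' ?_
  filter_upwards [eventually_ge_atTop 0] with x hx
  rw [rho_eq (isStepSet_biUnion hD).measurableSet hx, cumul_biUnion hD hd, Finset.sum_div]
  exact Finset.sum_congr rfl fun i hi => rho_eq (hD i hi).measurableSet hx

/-! ### Bounds for arbitrary weakly thinnable pairs -/

namespace IsWTP

variable {F : Set (Set ℝ)} {μ : Set ℝ → ℝ}

theorem isStepSet (h : IsWTP F μ) {A : Set ℝ} (hA : A ∈ F) : IsStepSet A :=
  mem_intervalSets_iff.1 (h.subset hA)

theorem halfLine_mem (h : IsWTP F μ) : halfLine ∈ F := by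
  obtain ⟨A, hA⟩ := h.pair.fsystem.nonempty
  have := h.pair.fsystem.union_mem A hA _ (h.pair.fsystem.compl_mem A hA) (by simp)
  rwa [union_sdiff_cancel (h.pair.fsystem.subset A hA)] at this

theorem map_compl (h : IsWTP F μ) {A : Set ℝ} (hA : A ∈ F) : μ (halfLine \ A) = 1 - μ A := by
  have := h.pair.additive A hA _ (h.pair.fsystem.compl_mem A hA) (by simp)
  rw [union_sdiff_cancel (h.pair.fsystem.subset A hA), h.pair.total] at this
  linarith

theorem density_mem (h : IsWTP F μ) {C : Set ℝ} (hC : C ∈ densitySets) : C ∈ F := by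
  have := h.thin_mem C hC _ h.halfLine_mem
  rwa [thin_halfLine (mem_intervalSets_iff.1 hC.1)] at this

theorem biUnion (h : IsWTP F μ) {ι : Type*} {s : Finset ι} {D : ι → Set ℝ}
    (hD : ∀ i ∈ s, D i ∈ F) (hd : (s : Set ι).PairwiseDisjoint D) :
    ⋃ i ∈ s, D i ∈ F ∧ μ (⋃ i ∈ s, D i) = ∑ i ∈ s, μ (D i) := by
  classical
  induction s using Finset.induction_on with
  | empty =>
    have h1 := h.pair.fsystem.compl_mem _ h.halfLine_mem
    have h2 := h.map_compl h.halfLine_mem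
    rw [h.pair.total, sub_self] at h2
    rw [Set.sdiff_self] at h1 h2
    simpa using ⟨h1, h2⟩
  | insert i s hi ih =>
    obtain ⟨h1, h2⟩ := ih (fun j hj => hD j (Finset.mem_insert_of_mem hj)) (hd.subset (by simp))
    have h3 := hD i (Finset.mem_insert_self _ _)
    have h4 : D i ∩ ⋃ j ∈ s, D j = ∅ :=
      inter_biUnion_eq_empty fun j hj => hd (by simp) (by simp [hj]) fun h => hi (h ▸ hj)
    rw [Finset.set_biUnion_insert, Finset.sum_insert hi, h.pair.additive _ h3 _ h1 h4, h2]
    exact ⟨h.pair.fsystem.union_mem _ h3 _ h1 h4, rfl⟩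

/-- The order property only needs the cumulative lengths to be ordered eventually: `A` may be
replaced by `[0, c) ∪ ([c, ∞) ∘ A)`, which has the same measure and dominates everything on
`[0, c]`. -/
theorem le_of_eventually (h : IsWTP F μ) {A B : Set ℝ} (hA : A ∈ F) (hB : B ∈ F)
    (hev : ∀ᶠ x in atTop, cumul B x ≤ cumul A x) : μ B ≤ μ A := by
  obtain ⟨c', hc'⟩ := eventually_atTop.1 hev
  set c : ℝ := max c' 0
  have hc0 : 0 ≤ c := le_max_right _ _
  have hle : ∀ x, c ≤ x → cumul B x ≤ cumul A x := fun x hx => hc' x ((le_max_left _ _).trans hx)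
  have hC := Ici_mem_densitySets hc0
  have hT := h.thin_mem _ hC A hA
  have hCc := h.pair.fsystem.compl_mem _ (h.density_mem hC)
  have hdis : halfLine \ Ici c ∩ thin (Ici c) A = ∅ :=
    eq_empty_of_forall_notMem fun y hy => hy.1.2 hy.2.2.1
  have hμ : μ (halfLine \ Ici c ∪ thin (Ici c) A) = μ A := by
    rw [h.pair.additive _ hCc _ hT hdis, h.map_compl (h.density_mem hC), h.thin_eq _ hC A hA,
      h.tail c hc0]
    ring
  rw [← hμ]
  refine h.order _ (h.pair.fsystem.union_mem _ hCc _ hT hdis) _ hB fun x hx => ?_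
  have hx : 0 ≤ x := hx
  rw [cumul_union (h.isStepSet hT).measurableSet hdis, cumul_compl (isStepSet_Ici hc0) hx,
    cumul_thin _ (h.isStepSet hA).measurableSet]
  rcases le_total x c with hxc | hxc
  · have : cumul (Ici c) x = 0 := by
      have := cumul_mono (Ici c) hxc
      rw [cumul_Ici hc0 le_rfl, sub_self] at this
      exact le_antisymm this (cumul_nonneg _ _)
    rw [this, cumul_of_nonpos A le_rfl]
    linarith [cumul_le_self B hx]
  · rw [cumul_Ici hc0 hxc]
    have := cumul_sub_le A (show x - c ≤ x by linarith)
    linarith [hle x hxc]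

theorem le_of_density (h : IsWTP F μ) {B C : Set ℝ} (hB : B ∈ F) (hC : C ∈ densitySets) {k l : ℝ}
    (hl : Tendsto (rho C) atTop (𝓝 l)) (hkl : k < l)
    (hev : ∀ᶠ x in atTop, cumul B x ≤ k * x) : μ B ≤ μ C := by
  refine h.le_of_eventually (h.density_mem hC) hB ?_
  filter_upwards [hev, hl.eventually_const_lt hkl, eventually_gt_atTop 0] with x h1 h2 hx
  rw [rho_eq (mem_intervalSets_iff.1 hC.1).measurableSet hx.le, lt_div_iff₀ hx] at h2
  exact h1.trans h2.le

/-- If `C` has density less than `k / n`, then `n μ(C) ≤ k`: the interval `[0, 1)` is cut into `n`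
equal parts, `C` is compared with the union of any `k` cyclically consecutive combs, and the `n`
resulting inequalities are added up. -/
theorem mul_le_of_density_lt (h : IsWTP F μ) {C : Set ℝ} (hC : C ∈ densitySets) {l : ℝ}
    (hl : Tendsto (rho C) atTop (𝓝 l)) {n k : ℕ} [NeZero n] (hk : k ≤ n) (hlt : l < k / n) :
    n * μ C ≤ k := by
  have hn : (0 : ℝ) < n := Nat.cast_pos.2 (NeZero.pos n)
  obtain ⟨m, hm1, hm2⟩ := exists_between hlt
  set e : Fin n → Set ℝ := fun i => comb ((i : ℕ) / n) (((i : ℕ) + 1) / n) with he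
  have b0 : ∀ i : Fin n, (0 : ℝ) ≤ (i : ℕ) / n := fun i => by positivity
  have b1 : ∀ i : Fin n, ((i : ℕ) / n : ℝ) ≤ ((i : ℕ) + 1) / n := fun i => by gcongr; linarith
  have b2 : ∀ i : Fin n, (((i : ℕ) + 1) / n : ℝ) ≤ 1 := fun i => by
    rw [div_le_one hn]
    exact_mod_cast i.2
  have hed : ∀ i, e i ∈ densitySets := fun i => comb_mem_densitySets (b0 i) (b1 i) (b2 i)
  have hes : ∀ i, IsStepSet (e i) := fun i => mem_intervalSets_iff.1 (hed i).1
  have hel : ∀ i, Tendsto (rho (e i)) atTop (𝓝 (1 / n)) := fun i => by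
    have := tendsto_rho_comb (b0 i) (b1 i) (b2 i)
    rwa [← sub_div, add_sub_cancel_left] at this
  have hlt' : ∀ i j : Fin n, i < j → Disjoint (e i) (e j) := fun i j hij => by
    refine comb_disjoint (b0 i) ?_ (b0 j) (b2 i) (b2 j)
    gcongr
    exact_mod_cast hij
  have hdis : ∀ i j, i ≠ j → Disjoint (e i) (e j) := fun i j hij => by
    rcases lt_or_gt_of_ne hij with h1 | h1
    · exact hlt' i j h1
    · exact (hlt' j i h1).symm
  set S : Finset (Fin n) := Finset.univ.filter fun i => (i : ℕ) < k with hS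
  have hScard : S.card = k := by
    rw [hS, Fin.card_filter_val_lt, min_eq_right hk]
  have key : ∀ j : Fin n, μ C ≤ ∑ i ∈ S, μ (e (i + j)) := fun j => by
    have hd : (S : Set (Fin n)).PairwiseDisjoint fun i => e (i + j) := fun i _ i' _ hne =>
      hdis _ _ fun h => hne (add_right_cancel h)
    have hU := tendsto_rho_biUnion (s := S) (fun i _ => hes (i + j)) hd fun i _ => hel (i + j)
    have hsum : ∑ _i ∈ S, (1 / n : ℝ) = k / n := by
      rw [Finset.sum_const, hScard, nsmul_eq_mul, mul_one_div]
    rw [hsum] at hU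
    rw [← (h.biUnion (s := S) (fun i _ => h.density_mem (hed (i + j))) hd).2]
    refine h.le_of_density (h.density_mem hC) ⟨mem_intervalSets_iff.2
      (isStepSet_biUnion fun i _ => hes (i + j)), _, hU⟩ hU hm2 ?_
    filter_upwards [hl.eventually_lt_const hm1, eventually_gt_atTop 0] with x h1 hx
    rw [rho_eq (mem_intervalSets_iff.1 hC.1).measurableSet hx.le, div_lt_iff₀ hx] at h1
    exact h1.le
  have htot : ∑ i, μ (e i) ≤ 1 := by
    obtain ⟨h1, h2⟩ := h.biUnion (s := Finset.univ) (fun i _ => h.density_mem (hed i))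
      fun i _ j _ hij => hdis i j hij
    rw [← h2]
    exact (h.pair.mem_unit _ h1).2
  calc (n : ℝ) * μ C = ∑ _j : Fin n, μ C := by simp
    _ ≤ ∑ j, ∑ i ∈ S, μ (e (i + j)) := Finset.sum_le_sum fun j _ => key j
    _ = ∑ i ∈ S, ∑ j, μ (e (i + j)) := Finset.sum_comm
    _ = ∑ _i ∈ S, ∑ j, μ (e j) := Finset.sum_congr rfl fun i _ =>
        Equiv.sum_comp (Equiv.addLeft i) fun j => μ (e j)
    _ ≤ ∑ _i ∈ S, (1 : ℝ) := Finset.sum_le_sum fun _ _ => htot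
    _ = k := by simp [hScard]

theorem le_density (h : IsWTP F μ) {C : Set ℝ} (hC : C ∈ densitySets) {l : ℝ}
    (hl : Tendsto (rho C) atTop (𝓝 l)) : μ C ≤ l := by
  by_contra! hlt
  have hl0 := (density_mem_Icc (mem_intervalSets_iff.1 hC.1).measurableSet hl).1
  have h1 := (h.pair.mem_unit C (h.density_mem hC)).2
  obtain ⟨q, hq1, hq2⟩ := exists_rat_btwn hlt
  have hq0 : 0 < q := by exact_mod_cast hl0.trans_lt hq1
  have hqn : ((q.num.toNat : ℕ) : ℤ) = q.num := Int.toNat_of_nonneg (Rat.num_pos.2 hq0).le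
  have hqe : (q : ℝ) = (q.num.toNat : ℝ) / q.den := by
    have h2 : ((q.num.toNat : ℕ) : ℝ) = (q.num : ℝ) := by exact_mod_cast hqn
    rw [h2, ← Rat.cast_def]
  have hd : (0 : ℝ) < q.den := Nat.cast_pos.2 q.pos
  have : NeZero q.den := ⟨q.den_nz⟩
  have hle : q.num.toNat ≤ q.den := by
    have : (q.num.toNat : ℝ) / q.den < 1 := hqe ▸ hq2.trans_le h1
    rw [div_lt_one hd] at this
    exact_mod_cast this.le
  have := h.mul_le_of_density_lt hC hl hle (hqe ▸ hq1)
  rw [hqe, div_lt_iff₀ hd] at hq2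
  linarith

/-- Every weakly thinnable pair extends natural density. -/
theorem eq_density (h : IsWTP F μ) {C : Set ℝ} (hC : C ∈ densitySets) {l : ℝ}
    (hl : Tendsto (rho C) atTop (𝓝 l)) : μ C = l := by
  have hs := mem_intervalSets_iff.1 hC.1
  refine le_antisymm (h.le_density hC hl) ?_
  have hl' : Tendsto (rho (halfLine \ C)) atTop (𝓝 (1 - l)) := by
    refine (hl.const_sub 1).congr' ?_
    filter_upwards [eventually_gt_atTop 0] with x hx
    rw [rho_eq hs.measurableSet hx.le, rho_eq hs.compl.measurableSet hx.le, cumul_compl hs hx.le,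
      sub_div, div_self hx.ne']
  have := h.le_density ⟨mem_intervalSets_iff.2 hs.compl, _, hl'⟩ hl'
  rw [h.map_compl (h.density_mem hC)] at this
  linarith

end IsWTP

/-- By the change of variables `τ = y e^{-u}`, integrating dilates of `S_A` over the dilation factor
gives a logarithmic average of `A`. -/
theorem integral_cumul_div {A : Set ℝ} {y N : ℝ} (hy : 0 < y) (hN : 1 < N) :
    ∫ τ in (1 : ℝ)..N, cumul A (y / τ) =
      y * Real.log N * mean (logRho A) (Real.log N, Real.log y - Real.log N) := by
  have hN0 : 0 < N := by linarith
  have hlog := Real.log_pos hN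
  have hd : ∀ u : ℝ, HasDerivAt (fun u => y * Real.exp (-u)) (-(y * Real.exp (-u))) u := fun u => by
    have := ((hasDerivAt_neg u).exp).const_mul y
    simpa using this
  have hc : Continuous fun u : ℝ => y * Real.exp (-u) := by fun_prop
  have hcont : ContinuousOn (fun τ => cumul A (y / τ)) ((fun u => y * Real.exp (-u)) ''
      uIcc (Real.log y) (Real.log y - Real.log N)) := by
    refine (continuous_cumul A).comp_continuousOn (continuousOn_const.div continuousOn_id ?_)
    rintro _ ⟨u, -, rfl⟩
    exact (mul_pos hy (Real.exp_pos _)).ne'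
  have h := intervalIntegral.integral_comp_mul_deriv'' hc.continuousOn
    (fun u _ => (hd u).hasDerivWithinAt) hc.neg.continuousOn hcont
  have e1 : y * Real.exp (-Real.log y) = 1 := by
    rw [Real.exp_neg, Real.exp_log hy, mul_inv_cancel₀ hy.ne']
  have e2 : y * Real.exp (-(Real.log y - Real.log N)) = N := by
    rw [neg_sub, Real.exp_sub, Real.exp_log hy, Real.exp_log hN0]
    field_simp
  rw [e1, e2] at h
  rw [← h, intervalIntegral.integral_symm, mean]
  simp only [sub_add_cancel]
  rw [← intervalIntegral.integral_neg, mul_assoc, ← mul_assoc (Real.log N),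
    mul_one_div_cancel hlog.ne', one_mul, ← intervalIntegral.integral_const_mul]
  refine intervalIntegral.integral_congr fun u _ => ?_
  have hu := (Real.exp_pos u).ne'
  simp only [Function.comp, logRho, Real.exp_neg]
  field_simp

theorem sum_cumul_div_le {A : Set ℝ} {y : ℝ} (hy : 0 < y) {N : ℕ} (hN : 1 < N) :
    ∑ i ∈ Finset.range N, cumul A (y / (i + 1)) ≤ y + y * Real.log N *
      mean (logRho A) (Real.log N, Real.log y - Real.log N) := by
  have hanti : AntitoneOn (fun τ => cumul A (y / τ)) (Icc ((1 : ℕ) : ℝ) N) := by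
    intro s hs t _ hst
    have hs0 : 0 < s := lt_of_lt_of_le (by norm_num) hs.1
    exact cumul_mono A (div_le_div_of_nonneg_left hy.le hs0 hst)
  have h := hanti.sum_le_integral_Ico hN.le
  rw [Nat.cast_one, integral_cumul_div hy (by exact_mod_cast hN)] at h
  rw [Finset.range_eq_Ico, Finset.sum_eq_sum_Ico_succ_bot (by omega : 0 < N)]
  push_cast at h ⊢
  have := cumul_le_self A hy.le
  simp only [zero_add, div_one] at h ⊢
  linarith

/-- If all logarithmic averages of `A` over long windows are asymptotically at most `K`, then
`μ(A) ≤ K` for every weakly thinnable pair. Take disjoint sets `D_i`, `i < N`, of density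
`c / (i + 1)` with `c⁻¹ = ∑ 1 / (i + 1)`, and `B = ⋃ D_i ∘ A`. Then `μ(B) = μ(A)`, while
`ρ_B(x) ≈ ∑ c / (i + 1) * ρ_A(c x / (i + 1))` is nearly a logarithmic average of `A`. Hence `ρ_B` is
eventually below `K` up to a small error, and `B` can be compared with a comb. -/
theorem IsWTP.le_of_mean_le {F : Set (Set ℝ)} {μ : Set ℝ → ℝ} (h : IsWTP F μ) {A : Set ℝ}
    (hA : A ∈ F) {K : ℝ}
    (hK : ∀ ε > 0, ∀ᶠ T in atTop, ∀ t > 0, mean (logRho A) (T, t) ≤ K + ε) : μ A ≤ K := by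
  refine le_of_forall_pos_le_add fun δ hδ => ?_
  rcases le_or_gt 1 (K + δ) with hbig | hbig
  · exact (h.pair.mem_unit A hA).2.trans hbig
  obtain ⟨ε, hε, hεδ⟩ : ∃ ε > 0, 4 * ε = δ := ⟨δ / 4, by linarith, by ring⟩
  have hlogT : Tendsto (fun N : ℕ => Real.log N) atTop atTop :=
    Real.tendsto_log_atTop.comp tendsto_natCast_atTop_atTop
  obtain ⟨N, hN1, hN2, hN3⟩ := ((hlogT.eventually (hK ε hε)).and
    ((hlogT.eventually_ge_atTop (1 / ε)).and (eventually_gt_atTop 1))).exists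
  have hlog : 0 < Real.log N := (one_div_pos.2 hε).trans_le hN2
  have hKε : 0 ≤ K + ε := (mean_logRho_mem_Icc A (p := (Real.log N, 1)) hlog).1.trans
    (hN1 1 one_pos)
  set H : ℝ := ∑ i ∈ Finset.range N, (1 : ℝ) / (i + 1) with hH
  have hHlog : Real.log N ≤ H := by
    have h1 := log_add_one_le_harmonic N
    have h2 : ((harmonic N : ℚ) : ℝ) = H := by simp [harmonic, hH]
    rw [h2] at h1
    refine (Real.log_le_log (by exact_mod_cast (by omega : 0 < N)) ?_).trans h1
    push_cast
    linarith
  have hH0 : 0 < H := hlog.trans_le hHlog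
  set c : ℝ := 1 / H with hc
  have hc0 : 0 < c := one_div_pos.2 hH0
  have hclog : c * Real.log N ≤ 1 := by
    rw [hc, one_div_mul_eq_div]
    exact div_le_one_of_le₀ hHlog hH0.le
  have hcε : c ≤ ε := by
    rw [hc, one_div_le hH0 hε]
    exact hN2.trans hHlog
  -- The endpoints of a partition of `[0, 1)` into `N` intervals of lengths `c / (i + 1)`.
  set p : ℕ → ℝ := fun j => c * ∑ i ∈ Finset.range j, (1 : ℝ) / (i + 1) with hp
  have hpsucc : ∀ j, p (j + 1) = p j + c / (j + 1) := fun j => by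
    simp only [hp, Finset.sum_range_succ]
    ring
  have hpm : Monotone p := monotone_nat_of_le_succ fun j => by
    rw [hpsucc]
    have : 0 < c / ((j : ℝ) + 1) := by positivity
    linarith
  have hp0 : ∀ j, 0 ≤ p j := fun j => by
    have : p 0 = 0 := by simp [hp]
    exact this ▸ hpm (Nat.zero_le j)
  have hp1 : ∀ j < N, p (j + 1) ≤ 1 := fun j hj => by
    have : p N = 1 := by
      change c * H = 1
      rw [hc, one_div_mul_cancel hH0.ne']
    exact this ▸ hpm hj
  set D : ℕ → Set ℝ := fun j => comb (p j) (p (j + 1)) with hD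
  have hDd : ∀ j ∈ Finset.range N, D j ∈ densitySets := fun j hj =>
    comb_mem_densitySets (hp0 j) (hpm j.le_succ) (hp1 j (Finset.mem_range.1 hj))
  have hDμ : ∀ j ∈ Finset.range N, μ (D j) = c / (j + 1) := fun j hj => by
    have := h.eq_density (hDd j hj)
      (tendsto_rho_comb (hp0 j) (hpm j.le_succ) (hp1 j (Finset.mem_range.1 hj)))
    rw [this, hpsucc]
    ring
  have hDlt : ∀ i < N, ∀ j < N, i < j → Disjoint (D i) (D j) := fun i hi j hj hij =>
    comb_disjoint (hp0 i) (hpm hij) (hp0 j) (hp1 i hi) (hp1 j hj)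
  have hdis : ((Finset.range N : Finset ℕ) : Set ℕ).PairwiseDisjoint fun j => thin (D j) A := by
    intro i hi j hj hij
    have hi := Finset.mem_range.1 (Finset.mem_coe.1 hi)
    have hj := Finset.mem_range.1 (Finset.mem_coe.1 hj)
    have : Disjoint (D i) (D j) := by
      rcases lt_or_gt_of_ne hij with h1 | h1
      · exact hDlt i hi j hj h1
      · exact (hDlt j hj i hi h1).symm
    exact this.mono (fun y hy => hy.2.1) fun y hy => hy.2.1
  have hTF : ∀ j ∈ Finset.range N, thin (D j) A ∈ F := fun j hj => h.thin_mem _ (hDd j hj) A hA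
  obtain ⟨hBF, hBμ⟩ := h.biUnion hTF hdis
  have hBA : μ (⋃ j ∈ Finset.range N, thin (D j) A) = μ A := by
    rw [hBμ, Finset.sum_congr rfl fun j hj => by rw [h.thin_eq _ (hDd j hj) A hA, hDμ j hj],
      ← Finset.sum_mul]
    have : ∑ j ∈ Finset.range N, c / ((j : ℝ) + 1) = 1 := by
      have h1 : c * H = 1 := one_div_mul_cancel hH0.ne'
      refine Eq.trans ?_ h1
      rw [hH, Finset.mul_sum]
      exact Finset.sum_congr rfl fun j _ => by rw [mul_one_div]
    rw [this, one_mul]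
  have hev : ∀ᶠ x in atTop, cumul (⋃ j ∈ Finset.range N, thin (D j) A) x ≤ (K + 3 * ε) * x := by
    filter_upwards [eventually_gt_atTop 0, eventually_ge_atTop (N / ε),
      eventually_gt_atTop (N / c)] with x hx hx1 hx2
    rw [cumul_biUnion (fun j hj => h.isStepSet (hTF j hj)) hdis]
    have hy : 0 < c * x := mul_pos hc0 hx
    have hyN : 0 < Real.log (c * x) - Real.log N := by
      rw [sub_pos]
      refine Real.log_lt_log (by exact_mod_cast (by omega : 0 < N)) ?_
      rwa [div_lt_iff₀' hc0] at hx2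
    have h1 : ∀ j ∈ Finset.range N, cumul (thin (D j) A) x ≤ cumul A (c * x / (j + 1)) + 1 :=
      fun j hj => by
        rw [cumul_thin _ (h.isStepSet hA).measurableSet]
        have h2 := abs_cumul_comb_sub_le (hp0 j) (hpm j.le_succ) (hp1 j (Finset.mem_range.1 hj))
          hx.le
        rw [show (p (j + 1) - p j) * x = c * x / (j + 1) by rw [hpsucc]; ring] at h2
        have h3 := (abs_cumul_sub_le A (cumul (D j) x) (c * x / (j + 1))).trans h2
        linarith [(abs_le.1 h3).2]
    have h2 := sum_cumul_div_le (A := A) hy hN3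
    have h3 := hN1 _ hyN
    have h4 : c * x * Real.log N * mean (logRho A) (Real.log N, Real.log (c * x) - Real.log N) ≤
        (K + ε) * x := by
      have h5 : c * x * Real.log N ≤ x := by
        have := mul_le_mul_of_nonneg_right hclog hx.le
        linarith
      have h6 : 0 ≤ c * x * Real.log N := (mul_pos hy hlog).le
      calc _ ≤ c * x * Real.log N * (K + ε) := mul_le_mul_of_nonneg_left h3 h6
        _ ≤ x * (K + ε) := mul_le_mul_of_nonneg_right h5 hKε
        _ = _ := mul_comm _ _
    have h5 : (N : ℝ) ≤ ε * x := by rwa [div_le_iff₀' hε] at hx1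
    have h6 : c * x ≤ ε * x := mul_le_mul_of_nonneg_right hcε hx.le
    calc ∑ j ∈ Finset.range N, cumul (thin (D j) A) x
        ≤ ∑ j ∈ Finset.range N, (cumul A (c * x / (j + 1)) + 1) := Finset.sum_le_sum h1
      _ = (∑ j ∈ Finset.range N, cumul A (c * x / (j + 1))) + N := by
        rw [Finset.sum_add_distrib]
        simp
      _ ≤ (K + 3 * ε) * x := by linarith
  have hl := tendsto_rho_comb le_rfl (by linarith : 0 ≤ K + δ) hbig.le
  have hE := comb_mem_densitySets le_rfl (by linarith : 0 ≤ K + δ) hbig.le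
  have hfin := h.le_of_density hBF hE hl (by linarith) hev
  rw [hBA, h.eq_density hE hl, sub_zero] at hfin
  exact hfin

theorem IsWTP.le_upperU {F : Set (Set ℝ)} {μ : Set ℝ → ℝ} (h : IsWTP F μ) {A : Set ℝ}
    (hA : A ∈ F) : μ A ≤ upperU (logSet A) := by
  have hs := h.isStepSet hA
  refine h.le_of_mean_le hA fun ε hε => ?_
  filter_upwards [eventually_sigma_lt hs.logSet.measurableSet (half_pos hε),
    eventually_gt_atTop 0, eventually_ge_atTop (2 / ε)] with T h1 hT h2 t ht
  have h3 := (abs_le.1 (abs_mean_logRho_sub_le hs hT ht.le)).2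
  have h4 : mean (ind (logSet A)) (T, t) < _ := h1 t ht
  have h5 : 1 / T ≤ ε / 2 := by
    rw [one_div_le hT (half_pos hε), one_div_div]
    exact h2
  linarith

theorem IsWTP.lowerL_le {F : Set (Set ℝ)} {μ : Set ℝ → ℝ} (h : IsWTP F μ) {A : Set ℝ}
    (hA : A ∈ F) : lowerL (logSet A) ≤ μ A := by
  have hs := h.isStepSet hA
  have key : μ (halfLine \ A) ≤ 1 - lowerL (logSet A) := by
    refine h.le_of_mean_le (h.pair.fsystem.compl_mem A hA) fun ε hε => ?_
    filter_upwards [eventually_lt_sigma hs.logSet.measurableSet (half_pos hε),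
      eventually_gt_atTop 0, eventually_ge_atTop (2 / ε)] with T h1 hT h2 t ht
    have h3 := (abs_le.1 (abs_mean_logRho_sub_le hs hT ht.le)).1
    have h4 : _ < mean (ind (logSet A)) (T, t) := h1 t ht
    have h5 : 1 / T ≤ ε / 2 := by
      rw [one_div_le hT (half_pos hε), one_div_div]
      exact h2
    rw [show logRho (halfLine \ A) = fun u => 1 - logRho A u from funext (logRho_compl hs),
      mean_sub continuous_const (continuous_logRho A), mean_const (p := (T, t)) 1 hT]
    linarith
  rw [h.map_compl hA] at key
  linarith

theorem eq_alpha_of_mem_WT {F : Set (Set ℝ)} {μ : Set ℝ → ℝ} (h : (F, μ) ∈ WT) {A : Set ℝ}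
    (hA : A ∈ F) (hA' : A ∈ Auni) : μ A = alpha A := by
  obtain ⟨-, h1, h2, -⟩ := Auni_spec hA'
  exact le_antisymm (h2 ▸ IsWTP.le_upperU h hA) (h1 ▸ IsWTP.lowerL_le h hA)

/-- If a pair agrees with all coherent weakly thinnable pairs, then each `A ∈ F` has the limiting
logarithmic average `μ(A)` along every ultrafilter of windows, hence along `windows` itself. -/
theorem subset_Auni_of_forall_WTC {F : Set (Set ℝ)} {μ : Set ℝ → ℝ} (h : (F, μ) ∈ WT)
    (hcan : ∀ A ∈ F, ∀ q ∈ WTC, A ∈ q.1 → μ A = q.2 A) : F ⊆ Auni := by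
  intro A hA
  have hAM := IsWTP.subset h hA
  refine mem_Auni_of_tendsto (l := μ A) hAM ?_
  rw [tendsto_iff_ultrafilter]
  intro G hG
  obtain ⟨ν, hν, hW⟩ := exists_mem_WTC_of_ultrafilter G hG
  rw [hcan A hA _ hW hAM]
  exact hν A

end WeakThinnability

open WeakThinnability
theorem theorem1 :
    -- (1) `(𝓐ᵘⁿⁱ, α)` is a WTP; `α` is well defined (`λ(log A)` exists) and coherent; it extends
    -- to a WTP on all of `𝓜`, in particular by limits of `ξ_A(s_n, f_n)` along a free ultrafilter
    ((Auni, alpha) ∈ WT ∧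
      (∀ A ∈ Auni, logSet A ∈ densitySets) ∧
      IsCoherent halfLine Auni alpha ∧
      (∃ μ : Set ℝ → ℝ, (intervalSets, μ) ∈ WT ∧ ∀ A ∈ Auni, μ A = alpha A) ∧
      (∀ (𝒰 : Ultrafilter ℕ) (s f : ℕ → ℝ), (𝒰 : Filter ℕ) ≤ cofinite →
        (∀ n, 1 < s n) → (∀ n, 1 < f n) → Tendsto s atTop atTop →
        ∃ μ : Set ℝ → ℝ,
          (∀ A ∈ intervalSets, Tendsto (fun n => xi A (s n) (f n)) 𝒰 (𝓝 (μ A))) ∧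
          (intervalSets, μ) ∈ WT ∧ ∀ A ∈ Auni, μ A = alpha A)) ∧
    -- (2) `(𝓐ᵘⁿⁱ, α)` is canonical with respect to `WT` and `WTC`, and
    -- `L(log A) ≤ μ(A) ≤ U(log A)` for every WTP `(F, μ)` and `A ∈ F`
    (IsCanonical WT (Auni, alpha) ∧ IsCanonical WTC (Auni, alpha) ∧
      (∀ (F : Set (Set ℝ)) (μ : Set ℝ → ℝ), (F, μ) ∈ WT → ∀ A ∈ F,
        lowerL (logSet A) ≤ μ A ∧ μ A ≤ upperU (logSet A))) ∧
    -- (3) maximality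
    (∀ (F : Set (Set ℝ)) (μ : Set ℝ → ℝ),
      IsCanonical WT (F, μ) ∨ IsCanonical WTC (F, μ) → F ⊆ Auni) := by
  have ext : ∀ μ : Set ℝ → ℝ, (intervalSets, μ) ∈ WT → ∀ A ∈ Auni, μ A = alpha A :=
    fun μ h A hA => eq_alpha_of_mem_WT h hA.1 hA
  refine ⟨⟨Auni_mem_WTC.1, fun A hA => (Auni_spec hA).1, Auni_mem_WTC.2, ?_, ?_⟩,
    ⟨⟨Auni_mem_WTC.1, fun A hA q hq hAq => (eq_alpha_of_mem_WT hq hAq hA).symm⟩,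
      ⟨Auni_mem_WTC, fun A hA q hq hAq => (eq_alpha_of_mem_WT hq.1 hAq hA).symm⟩,
      fun F μ h A hA => ⟨IsWTP.lowerL_le h hA, IsWTP.le_upperU h hA⟩⟩, ?_⟩
  · obtain ⟨μ, -, h⟩ := exists_mem_WTC_of_ultrafilter (Ultrafilter.of windows)
      (Ultrafilter.of_le windows)
    exact ⟨μ, h.1, ext μ h.1⟩
  · intro 𝒰 s f h𝒰 hs hf hst
    have hG : ((𝒰.map fun n => (Real.log (s n), Real.log (f n)) : Ultrafilter (ℝ × ℝ)) :
        Filter (ℝ × ℝ)) ≤ windows := by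
      refine tendsto_prod_iff'.2 ⟨?_, ?_⟩
      · exact (Real.tendsto_log_atTop.comp hst).mono_left (Nat.cofinite_eq_atTop ▸ h𝒰)
      · exact tendsto_principal.2 (Eventually.of_forall fun n => Real.log_pos (hf n))
    obtain ⟨μ, h1, h2⟩ := exists_mem_WTC_of_ultrafilter _ hG
    refine ⟨μ, fun A hA => ?_, h2.1, ext μ h2.1⟩
    refine (tendsto_map'_iff.1 (h1 A)).congr fun n => ?_
    exact (xi_eq_mean (mem_intervalSets_iff.1 hA).measurableSet (by linarith [hs n])
      (by linarith [hf n])).symm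
  · rintro F μ (h | h)
    · exact subset_Auni_of_forall_WTC h.1 fun A hA q hq => h.2 A hA q hq.1
    · exact subset_Auni_of_forall_WTC h.1.1 h.2
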